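/- **Conventions.** Tense formulas are built from variables $p_i$ ($i\in\mathbb N$) with $\bot$, $\to$, $\Box$ (future necessity) and $\blacklozenge$ (past possibility); $\neg,\wedge,\vee$ are defined as usual and $\Diamond\varphi:=\neg\Box\neg\varphi$. A *tense logic* is a set $L$ of formulas that contains all instances of classical tautologies, is closed under modus ponens and substitution, and satisfies $\blacklozenge\varphi\to\psi\in L$ iff $\varphi\to\Box\psi\in L$. Let $\mathsf K_t$ be the least tense logic and $L\oplus\Gamma$ the least tense logic containing $L\cup\Gamma$. A *frame* is a pair $(X,R)$ with $X\neq\varnothing$ and $R\subseteq X\times X$; $\Box$ quantifies over $R$-successors, $\blacklozenge$ over $R$-predecessors. $\mathsf{Log}(\mathcal K)$ is the set of formulas valid in all frames of $\mathcal K$. Let $\mathsf{S4}_t=\mathsf K_t\oplus\{\Box p_0\to p_0,\ \Box p_0\to\Box\Box p_0\}$, put $\Delta^0\varphi=\varphi$ and $\Delta^{k+1}\varphi=\Delta^k\varphi\vee\Diamond\Delta^k\varphi\vee\blacklozenge\Delta^k\varphi$, and let $\mathsf{S4.3}_t$ (the tense logic of linear preorders) be $\mathsf{S4}_t$ extended by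 $$\Delta^2p_0\to\Delta^1p_0,$$ $$\Diamond p_0\wedge\Diamond p_1\to\Diamond(p_0\wedge(p_1\vee\Diamond p_1))\vee\Diamond(p_1\wedge(p_0\vee\Diamond p_0)),$$ $$\blacklozenge p_0\wedge\blacklozenge p_1\to\blacklozenge(p_0\wedge(p_1\vee\blacklozenge p_1))\vee\blacklozenge(p_1\wedge(p_0\vee\blacklozenge p_0)).$$ A tense logic is *consistent* if it does not contain $\bot$; *tabular* if it equals $\mathsf{Log}(\{\mathfrak F\})$ for some finite frame $\mathfrak F$; and *pretabular* if it is not tabular but all its consistent proper extensions (among tense logics) are tabular. A tense logic $L$ has the *finite model property* if $L=\mathsf{Log}(\mathcal K)$, where $\mathcal K$ is the class of all finite frames validating $L$; it is *finitely axiomatizable* if $L=\mathsf K_t\oplus\Gamma$ for some finite $\Gamma$; and *decidable* if there is an algorithm deciding, given a formula $\varphi$, whether $\varphi\in L$. **Theorem.** Let $L\supseteq\mathsf{S4.3}_t$ be a pretabular tense logic. Then $L$ is finitely axiomatizable, has the finite model property, and is decidable. -/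

import Mathlib

namespace Tense

/-- Formulas of the tense language: variables `p i`, falsum, implication, the forward-looking
box `□` (`box`) and the backward-looking diamond `◆` (`bdia`). -/
inductive Formula : Type
  | p : ℕ → Formula
  | bot : Formula
  | imp : Formula → Formula → Formula
  | box : Formula → Formula
  | bdia : Formula → Formula

namespace Formula

def neg (φ : Formula) : Formula := imp φ bot
def and (φ ψ : Formula) : Formula := neg (imp φ (neg ψ))
def or (φ ψ : Formula) : Formula := imp (neg φ) ψ
/-- `◇φ := ¬□¬φ`. -/
def dia (φ : Formula) : Formula := neg (box (neg φ))

/-- The homomorphism of the formula algebra given by the values `s` on the variables. -/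
def subst (s : ℕ → Formula) : Formula → Formula
  | p i => s i
  | bot => bot
  | imp φ ψ => imp (subst s φ) (subst s ψ)
  | box φ => box (subst s φ)
  | bdia φ => bdia (subst s φ)

/-- `φ` is a substitution instance of a classical propositional tautology: every assignment of
truth values to formulas that respects `⊥` and `→` (and treats variables and formulas of the form
`□ψ`, `◆ψ` as atoms) makes `φ` true. -/
def IsTautologyInstance (φ : Formula) : Prop :=
  ∀ v : Formula → Prop, ¬ v bot → (∀ χ ψ, v (imp χ ψ) ↔ (v χ → v ψ)) → v φ

/-- `Δ⁰φ = φ`, `Δᵏ⁺¹φ = Δᵏφ ∨ ◇Δᵏφ ∨ ◆Δᵏφ`. -/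
def delta : ℕ → Formula → Formula
  | 0, φ => φ
  | k + 1, φ => or (or (delta k φ) (dia (delta k φ))) (bdia (delta k φ))

/-- A Gödel numbering of the formulas. -/
def code : Formula → ℕ
  | bot => 0
  | p i => 4 * i + 1
  | box φ => 4 * code φ + 2
  | bdia φ => 4 * code φ + 3
  | imp φ ψ => 4 * Nat.pair (code φ) (code ψ) + 4

/-- The inverse of the Gödel numbering. -/
def decode : ℕ → Formula
  | 0 => bot
  | n + 1 =>
    have h1 : n / 4 < n + 1 := Nat.lt_succ_of_le (Nat.div_le_self n 4)
    have _h2 : (n / 4).unpair.1 < n + 1 := lt_of_le_of_lt (Nat.unpair_left_le _) h1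
    have _h3 : (n / 4).unpair.2 < n + 1 := lt_of_le_of_lt (Nat.unpair_right_le _) h1
    if n % 4 = 0 then p (n / 4)
    else if n % 4 = 1 then box (decode (n / 4))
    else if n % 4 = 2 then bdia (decode (n / 4))
    else imp (decode (n / 4).unpair.1) (decode (n / 4).unpair.2)

theorem decode_code (φ : Formula) : decode (code φ) = φ := by
  induction φ with
  | bot => simp [code, decode]
  | p i =>
    have h2 : (4 * i) / 4 = i := by omega
    simp [code, decode]
  | box φ ih =>
    have h1 : (4 * code φ + 1) % 4 = 1 := by omega
    have h2 : (4 * code φ + 1) / 4 = code φ := by omega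
    simp [code, decode, h1, h2, ih]
  | bdia φ ih =>
    have h1 : (4 * code φ + 2) % 4 = 2 := by omega
    have h2 : (4 * code φ + 2) / 4 = code φ := by omega
    simp [code, decode, h1, h2, ih]
  | imp φ ψ ih1 ih2 =>
    have h1 : (4 * Nat.pair (code φ) (code ψ) + 3) % 4 = 3 := by omega
    have h2 : (4 * Nat.pair (code φ) (code ψ) + 3) / 4 = Nat.pair (code φ) (code ψ) := by omega
    simp [code, decode, h1, h2, ih1, ih2]

theorem code_decode (n : ℕ) : code (decode n) = n := by
  induction n using Nat.strong_induction_on with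
  | _ n ih =>
    cases n with
    | zero => simp [code, decode]
    | succ n =>
      have h1 : n / 4 < n + 1 := Nat.lt_succ_of_le (Nat.div_le_self n 4)
      have h2 := ih _ (lt_of_le_of_lt (Nat.unpair_left_le (n / 4)) h1)
      have h3 := ih _ (lt_of_le_of_lt (Nat.unpair_right_le (n / 4)) h1)
      have h4 := ih _ h1
      rw [decode]
      split_ifs <;> simp only [code, h2, h3, h4, Nat.pair_unpair] <;> omega

instance : Denumerable Formula :=
  Denumerable.mk' ⟨code, decode, decode_code, code_decode⟩

end Formula

open Formula in
/-- A (normal) tense logic. -/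
structure IsTenseLogic (L : Set Formula) : Prop where
  taut : ∀ φ, IsTautologyInstance φ → φ ∈ L
  adj : ∀ φ ψ, imp (bdia φ) ψ ∈ L ↔ imp φ (box ψ) ∈ L
  mp : ∀ φ ψ, φ ∈ L → imp φ ψ ∈ L → ψ ∈ L
  subst_mem : ∀ φ (s : ℕ → Formula), φ ∈ L → subst s φ ∈ L

/-- `L ⊕ Γ`: the smallest tense logic containing `L ∪ Γ`. -/
def oplus (L Γ : Set Formula) : Set Formula :=
  {φ | ∀ M : Set Formula, IsTenseLogic M → L ∪ Γ ⊆ M → φ ∈ M}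

/-- The least tense logic. -/
def Kt : Set Formula := oplus ∅ ∅

open Formula in
/-- `S4_t = K_t ⊕ {□p → p, □p → □□p}`, the tense logic of preorders. -/
def S4t : Set Formula :=
  oplus Kt {imp (box (p 0)) (p 0), imp (box (p 0)) (box (box (p 0)))}

open Formula in
/-- `bz_n = Δⁿ⁺¹p → Δⁿp`: z-degree at most `n`. -/
def bz (n : ℕ) : Formula := imp (delta (n + 1) (p 0)) (delta n (p 0))

open Formula in
/-- Forth-width at most one:
`◇p₀ ∧ ◇p₁ → ◇(p₀ ∧ (p₁ ∨ ◇p₁)) ∨ ◇(p₁ ∧ (p₀ ∨ ◇p₀))`. -/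
def bwForth1 : Formula :=
  imp (and (dia (p 0)) (dia (p 1)))
    (or (dia (and (p 0) (or (p 1) (dia (p 1))))) (dia (and (p 1) (or (p 0) (dia (p 0))))))

open Formula in
/-- Back-width at most one: the same with `◆` in place of `◇`. -/
def bwBack1 : Formula :=
  imp (and (bdia (p 0)) (bdia (p 1)))
    (or (bdia (and (p 0) (or (p 1) (bdia (p 1))))) (bdia (and (p 1) (or (p 0) (bdia (p 0))))))

/-- `S4.3_t`: the extension of `S4_t` by z-degree, forth-width and back-width at most one. -/
def S43t : Set Formula := oplus S4t {bz 1, bwForth1, bwBack1}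

/-- The set `NExt(L)` of all tense logics extending `L`. -/
def NExt (L : Set Formula) : Set (Set Formula) := {M | IsTenseLogic M ∧ L ⊆ M}

/-- A (Kripke) frame. -/
structure KFrame where
  X : Type
  nonempty : Nonempty X
  R : X → X → Prop

/-- Truth at a point under the valuation `V`. -/
def KFrame.Sat (F : KFrame) (V : ℕ → Set F.X) : F.X → Formula → Prop
  | x, .p i => x ∈ V i
  | _, .bot => False
  | x, .imp φ ψ => F.Sat V x φ → F.Sat V x ψ
  | x, .box φ => ∀ y, F.R x y → F.Sat V y φ
  | x, .bdia φ => ∃ y, F.R y x ∧ F.Sat V y φ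

def KFrame.Valid (F : KFrame) (φ : Formula) : Prop :=
  ∀ (V : ℕ → Set F.X) (x : F.X), F.Sat V x φ

/-- `Log(K)`: the formulas valid in all frames of the class `K`. -/
def Log (K : Set KFrame) : Set Formula := {φ | ∀ F ∈ K, F.Valid φ}

/-- `Fin(L)`: the class of finite frames validating `L`. -/
def FinFrames (L : Set Formula) : Set KFrame := {F | Finite F.X ∧ ∀ φ ∈ L, F.Valid φ}

/-- The finite model property. -/
def HasFMP (L : Set Formula) : Prop := L = Log (FinFrames L)

/-- `L` is the logic of a single finite frame. -/
def IsTabular (L : Set Formula) : Prop := ∃ F : KFrame, Finite F.X ∧ L = Log {F}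

def IsConsistent (L : Set Formula) : Prop := Formula.bot ∉ L

/-- `L` is a non-tabular tense logic all of whose consistent proper extensions are tabular. -/
structure IsPretabular (L : Set Formula) : Prop where
  isTenseLogic : IsTenseLogic L
  not_tabular : ¬ IsTabular L
  tabular_of_ssubset : ∀ M, IsTenseLogic M → L ⊂ M → IsConsistent M → IsTabular M

/-- `PTAB(L)`: the pretabular tense logics in `NExt(L)`. -/
def PTAB (L : Set Formula) : Set (Set Formula) := {M | M ∈ NExt L ∧ IsPretabular M}

/-- `L = K_t ⊕ Γ` for some finite set `Γ` of formulas. -/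
def IsFinitelyAxiomatizable (L : Set Formula) : Prop :=
  ∃ Γ : Set Formula, Γ.Finite ∧ L = oplus Kt Γ

/-- Membership in `L` is decided by an algorithm (a total recursive function on Gödel numbers). -/
def IsDecidable (L : Set Formula) : Prop := ComputablePred fun φ : Formula => φ ∈ L

end Tense

/-! The canonical frame of a logic `L` above `S4.3_t` splits into components, each a total preorder
of clusters. Everything follows from a dichotomy (`isTabular_or_subset_family`): a consistent `L` is
either tabular or contained in the logic of one of five families of finite frames, namely chains,
and clusters of growing size with or without one point below and one point above.

For the dichotomy, a strict chain of `n + 1` worlds in a component yields a definable bounded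
morphism onto the `n + 1`-point chain (`valid_chain_of_lt`). So if some chain refutes a formula of
`L`, strict chains have bounded length, and then up-sets and down-sets of worlds are definable in
their component. A large cluster can now be mapped onto a large member of a cluster family,
collapsing all worlds below it to one point and all worlds above it to another
(`valid_cluster_of_card`). If each of those four families also refutes something in `L`, clusters
are bounded, hence so are components, and `L` is the logic of a finite disjoint union of finite
frames (`isTabular_of_card_le`).

The logic of each family is consistent and not tabular, so a consistent pretabular `L` coincides
with it. Finitely many axioms capture a family: any logic above `S4.3_t` containing them refutes
each of its non-theorems `φ` on every member of the family with index at least `FrameType.bound φ`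
(`not_valid_of_notMem`), by selecting finitely many worlds of a canonical component. Hence `L` is
finitely axiomatizable; it has the finite model property because the family is finite frames; and
membership of `φ` amounts to validity in one frame whose size is computed from `φ`, which is a
primitive recursive test. The inconsistent logic is treated apart. -/

namespace Tense

open Formula

/-! ### Kripke semantics -/

namespace KFrame

variable {F : KFrame} {V : ℕ → Set F.X} {x : F.X} {φ ψ : Formula}

@[simp] theorem sat_p {i : ℕ} : F.Sat V x (.p i) ↔ x ∈ V i := Iff.rfl
@[simp] theorem sat_bot : ¬ F.Sat V x .bot := id
@[simp] theorem sat_imp : F.Sat V x (φ.imp ψ) ↔ (F.Sat V x φ → F.Sat V x ψ) := Iff.rfl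
@[simp] theorem sat_box : F.Sat V x φ.box ↔ ∀ y, F.R x y → F.Sat V y φ := Iff.rfl
@[simp] theorem sat_bdia : F.Sat V x φ.bdia ↔ ∃ y, F.R y x ∧ F.Sat V y φ := Iff.rfl
@[simp] theorem sat_neg : F.Sat V x φ.neg ↔ ¬ F.Sat V x φ := Iff.rfl
@[simp] theorem sat_and : F.Sat V x (φ.and ψ) ↔ F.Sat V x φ ∧ F.Sat V x ψ := by
  simp [Formula.and]
@[simp] theorem sat_dia : F.Sat V x φ.dia ↔ ∃ y, F.R x y ∧ F.Sat V y φ := by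
  simp [Formula.dia]

theorem sat_subst (s : ℕ → Formula) (φ : Formula) (V : ℕ → Set F.X) (x : F.X) :
    F.Sat V x (φ.subst s) ↔ F.Sat (fun i => {y | F.Sat V y (s i)}) x φ := by
  induction φ generalizing x with
  | p i => rfl
  | bot => rfl
  | imp φ ψ h1 h2 => simp [subst, h1, h2]
  | box φ h => simp [subst, h]
  | bdia φ h => simp [subst, h]

end KFrame

theorem isTenseLogic_Log (K : Set KFrame) : IsTenseLogic (Log K) where
  taut φ h F _ V x := h (fun ψ => F.Sat V x ψ) (by simp) (by simp)
  adj φ ψ := by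
    constructor
    · intro h F hF V x hx y hxy
      exact h F hF V y ⟨x, hxy, hx⟩
    · rintro h F hF V x ⟨y, hyx, hy⟩
      exact h F hF V y hy x hyx
  mp φ ψ h1 h2 F hF V x := h2 F hF V x (h1 F hF V x)
  subst_mem φ s h F hF V x := (KFrame.sat_subst s φ V x).2 (h F hF _ x)

theorem isConsistent_Log {K : Set KFrame} (h : K.Nonempty) : IsConsistent (Log K) := by
  obtain ⟨F, hF⟩ := h
  obtain ⟨x⟩ := F.nonempty
  exact fun hb => hb F hF (fun _ => ∅) x

theorem isTenseLogic_oplus (L Γ : Set Formula) : IsTenseLogic (oplus L Γ) where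
  taut φ h _ hM _ := hM.taut φ h
  adj φ ψ := forall_congr' fun _ => forall_congr' fun hM => forall_congr' fun _ => hM.adj φ ψ
  mp φ ψ h1 h2 M hM h := hM.mp φ ψ (h1 M hM h) (h2 M hM h)
  subst_mem φ s h1 M hM h := hM.subst_mem φ s (h1 M hM h)

theorem subset_oplus_left (L Γ : Set Formula) : L ⊆ oplus L Γ :=
  fun _ hφ _ _ h => h (Or.inl hφ)

theorem subset_oplus_right (L Γ : Set Formula) : Γ ⊆ oplus L Γ :=
  fun _ hφ _ _ h => h (Or.inr hφ)

theorem oplus_subset {L Γ M : Set Formula} (hM : IsTenseLogic M) (hL : L ⊆ M) (hΓ : Γ ⊆ M) :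
    oplus L Γ ⊆ M :=
  fun _ hφ => hφ M hM (Set.union_subset hL hΓ)

theorem Kt_subset {M : Set Formula} (hM : IsTenseLogic M) : Kt ⊆ M :=
  oplus_subset hM (Set.empty_subset _) (Set.empty_subset _)

/-! ### Worlds of the canonical frame -/

/-- The maximal consistent extensions of `L`. -/
structure World (L : Set Formula) where
  carrier : Set Formula
  sub : L ⊆ carrier
  bot_notMem' : Formula.bot ∉ carrier
  imp_mem' : ∀ φ ψ, φ.imp ψ ∈ carrier ↔ (φ ∈ carrier → ψ ∈ carrier)

namespace World

variable {L : Set Formula}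

instance : Membership Formula (World L) := ⟨fun w φ => φ ∈ w.carrier⟩

variable {w : World L} {φ ψ : Formula}

theorem of_logic (h : φ ∈ L) : φ ∈ w := w.sub h
@[simp] theorem bot_notMem : Formula.bot ∉ w := w.bot_notMem'
@[simp] theorem imp_mem : φ.imp ψ ∈ w ↔ (φ ∈ w → ψ ∈ w) := w.imp_mem' φ ψ
@[simp] theorem neg_mem : φ.neg ∈ w ↔ φ ∉ w := by simp [Formula.neg]
@[simp] theorem and_mem : φ.and ψ ∈ w ↔ φ ∈ w ∧ ψ ∈ w := by simp [Formula.and]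
@[simp] theorem or_mem : φ.or ψ ∈ w ↔ φ ∈ w ∨ ψ ∈ w := by
  simp [Formula.or, or_iff_not_imp_left]

theorem ext' {w u : World L} (h : ∀ φ, φ ∈ w → φ ∈ u) : w = u := by
  have h' : w.carrier = u.carrier := by
    ext φ
    refine ⟨h φ, fun hu => ?_⟩
    by_contra hw
    exact neg_mem.1 (h _ (neg_mem.2 hw)) hu
  cases w; cases u; simp at h'; simp [h']

theorem exists_of_ne {w u : World L} (h : w ≠ u) : ∃ φ, φ ∈ w ∧ φ ∉ u := by
  by_contra hc
  push Not at hc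
  exact h (ext' hc)

end World

/-- Lindenbaum's lemma: among the sets containing `L`, closed under modus ponens and omitting `ψ`, a
maximal one above the consequences of `D` is a world. -/
theorem World.exists_of_directed {L : Set Formula} (hL : IsTenseLogic L) {D : Set Formula}
    (hne : D.Nonempty) (hand : ∀ χ ∈ D, ∀ θ ∈ D, χ.and θ ∈ D) {ψ : Formula}
    (hψ : ∀ χ ∈ D, χ.imp ψ ∉ L) : ∃ w : World L, (∀ χ ∈ D, χ ∈ w) ∧ ψ ∉ w := by
  let S : Set (Set Formula) :=
    {T | L ⊆ T ∧ (∀ φ χ, φ ∈ T → φ.imp χ ∈ T → χ ∈ T) ∧ ψ ∉ T}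
  let T₀ : Set Formula := {θ | ∃ χ ∈ D, χ.imp θ ∈ L}
  have hT₀ : T₀ ∈ S := by
    refine ⟨?_, ?_, ?_⟩
    · intro θ hθ
      obtain ⟨χ, hχ⟩ := hne
      refine ⟨χ, hχ, hL.mp _ _ hθ (hL.taut _ ?_)⟩
      intro v _ hi
      simp only [hi]; tauto
    · rintro φ χ ⟨a, ha, ha'⟩ ⟨b, hb, hb'⟩
      refine ⟨_, hand a ha b hb, hL.mp _ _ hb' (hL.mp _ _ ha' (hL.taut _ ?_))⟩
      intro v h0 hi
      simp only [hi, Formula.and, Formula.neg, h0]; tauto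
    · rintro ⟨χ, hχ, h⟩
      exact hψ χ hχ h
  obtain ⟨T, hT₀T, hT⟩ := zorn_subset_nonempty S (by
    intro c hcS hc hcne
    refine ⟨⋃₀ c, ⟨?_, ?_, ?_⟩, fun s hs => Set.subset_sUnion_of_mem hs⟩
    · obtain ⟨s, hs⟩ := hcne
      exact (hcS hs).1.trans (Set.subset_sUnion_of_mem hs)
    · rintro φ χ ⟨a, ha, ha'⟩ ⟨b, hb, hb'⟩
      rcases hc.total ha hb with h | h
      · exact ⟨b, hb, (hcS hb).2.1 φ χ (h ha') hb'⟩
      · exact ⟨a, ha, (hcS ha).2.1 φ χ ha' (h hb')⟩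
    · rintro ⟨s, hs, hs'⟩
      exact (hcS hs).2.2 hs') T₀ hT₀
  obtain ⟨⟨hLT, hmp, hψT⟩, hmax⟩ := hT
  -- Deduction theorem: `{θ | χ → θ ∈ T}` contains `T` and `χ` and is closed under modus ponens, so
  -- by maximality it cannot omit `ψ`.
  have key : ∀ χ, χ ∉ T → χ.imp ψ ∈ T := by
    intro χ hχ
    by_contra hc
    have hS : {θ | χ.imp θ ∈ T} ∈ S := by
      refine ⟨fun θ hθ => ?_, fun φ θ h1 h2 => ?_, hc⟩
      · refine hmp _ _ (hLT hθ) (hLT (hL.taut _ ?_))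
        intro v _ hi
        simp only [hi]; tauto
      · refine hmp _ _ h2 (hmp _ _ h1 (hLT (hL.taut _ ?_)))
        intro v _ hi
        simp only [hi]; tauto
    refine hχ (hmax hS (fun θ hθ => ?_) (hLT (hL.taut _ ?_)))
    · refine hmp _ _ hθ (hLT (hL.taut _ ?_))
      intro v _ hi
      simp only [hi]; tauto
    · intro v _ hi
      simp only [hi]; tauto
  refine ⟨⟨T, hLT, fun hb => hψT (hmp _ _ hb (hLT (hL.taut _ ?_))), fun φ χ =>
    ⟨fun h hφ => hmp _ _ hφ h, fun h => ?_⟩⟩, fun χ hχ => hT₀T ⟨χ, hχ, hL.taut _ ?_⟩, hψT⟩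
  · intro v h0 hi
    simp only [hi]; tauto
  · by_cases hφ : φ ∈ T
    · refine hmp _ _ (h hφ) (hLT (hL.taut _ ?_))
      intro v _ hi
      simp only [hi]; tauto
    -- By `key` both `φ → ψ` and `(φ → χ) → ψ` lie in `T`, and these two imply `ψ` classically.
    · by_contra hc
      refine hψT (hmp _ _ (key _ hφ) (hmp _ _ (key _ hc) (hLT (hL.taut _ ?_))))
      intro v _ hi
      simp only [hi]; tauto
  · intro v _ hi
    simp only [hi]; tauto

theorem mem_of_forall_world {L : Set Formula} (hL : IsTenseLogic L) {φ : Formula}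
    (h : ∀ w : World L, φ ∈ w) : φ ∈ L := by
  by_contra hφ
  obtain ⟨w, -, hw⟩ := World.exists_of_directed hL (D := L) (ψ := φ)
    ⟨Formula.bot.imp .bot, hL.taut _ (fun v _ hi => by simp only [hi]; tauto)⟩
    (fun χ hχ θ hθ => hL.mp _ _ hθ (hL.mp _ _ hχ (hL.taut _ (by
      intro v h0 hi
      simp only [hi, Formula.and, Formula.neg, h0]; tauto))))
    (fun χ hχ hc => hφ (hL.mp _ _ hχ hc))
  exact hw (h w)

theorem exists_world_of_notMem {L : Set Formula} (hL : IsTenseLogic L) {φ : Formula}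
    (h : φ ∉ L) : ∃ w : World L, φ ∉ w := by
  by_contra hc
  push Not at hc
  exact h (mem_of_forall_world hL hc)

/-! ### Normal operators and their canonical relations -/

/-- The past box. -/
def Formula.bbox (φ : Formula) : Formula := φ.neg.bdia.neg

/-- `B` is a normal necessity operator of `L`. -/
structure IsNormal (L : Set Formula) (B : Formula → Formula) : Prop where
  mono : ∀ φ ψ, φ.imp ψ ∈ L → (B φ).imp (B ψ) ∈ L
  and : ∀ φ ψ, ((B φ).and (B ψ)).imp (B (φ.and ψ)) ∈ L
  nec : ∀ φ, φ ∈ L → B φ ∈ L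

/-- The canonical relation of the operator `B`. -/
def Rel {L : Set Formula} (B : Formula → Formula) (x y : World L) : Prop :=
  ∀ φ, B φ ∈ x → φ ∈ y

section

variable {L : Set Formula} (hL : IsTenseLogic L)
include hL

theorem mem_imp_of_forall {φ ψ : Formula} (h : ∀ w : World L, φ ∈ w → ψ ∈ w) : φ.imp ψ ∈ L :=
  mem_of_forall_world hL fun w => World.imp_mem.2 (h w)

end

section

variable {L : Set Formula}

theorem World.of_imp {φ ψ : Formula} (h : φ.imp ψ ∈ L) {w : World L} (hw : φ ∈ w) : ψ ∈ w :=
  World.imp_mem.1 (World.of_logic h) hw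

theorem IsTenseLogic.imp_trans (hL : IsTenseLogic L) {φ ψ χ : Formula} (h1 : φ.imp ψ ∈ L)
    (h2 : ψ.imp χ ∈ L) : φ.imp χ ∈ L :=
  mem_imp_of_forall hL fun _ h => World.of_imp h2 (World.of_imp h1 h)

theorem IsTenseLogic.imp_self (hL : IsTenseLogic L) (φ : Formula) : φ.imp φ ∈ L :=
  mem_imp_of_forall hL fun _ h => h

theorem IsTenseLogic.bdia_box (hL : IsTenseLogic L) (φ : Formula) : φ.box.bdia.imp φ ∈ L :=
  (hL.adj _ _).2 (hL.imp_self _)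

theorem IsTenseLogic.box_bdia (hL : IsTenseLogic L) (φ : Formula) : φ.imp φ.bdia.box ∈ L :=
  (hL.adj _ _).1 (hL.imp_self _)

theorem IsTenseLogic.box_mono (hL : IsTenseLogic L) {φ ψ : Formula} (h : φ.imp ψ ∈ L) :
    φ.box.imp ψ.box ∈ L :=
  (hL.adj _ _).1 (hL.imp_trans (hL.bdia_box φ) h)

theorem IsTenseLogic.bdia_mono (hL : IsTenseLogic L) {φ ψ : Formula} (h : φ.imp ψ ∈ L) :
    φ.bdia.imp ψ.bdia ∈ L :=
  (hL.adj _ _).2 (hL.imp_trans h (hL.box_bdia ψ))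

theorem IsTenseLogic.normal_box (hL : IsTenseLogic L) : IsNormal L box where
  mono _ _ h := hL.box_mono h
  and φ ψ := by
    refine (hL.adj _ _).1 (mem_imp_of_forall hL fun w hw => World.and_mem.2 ⟨?_, ?_⟩)
    · refine World.of_imp (hL.bdia_box φ) (World.of_imp (hL.bdia_mono ?_) hw)
      exact mem_imp_of_forall hL fun w hw => (World.and_mem.1 hw).1
    · refine World.of_imp (hL.bdia_box ψ) (World.of_imp (hL.bdia_mono ?_) hw)
      exact mem_imp_of_forall hL fun w hw => (World.and_mem.1 hw).2
  nec φ h := by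
    refine hL.mp (Formula.bot.imp .bot) _ (hL.imp_self _) ((hL.adj _ _).1 ?_)
    exact mem_imp_of_forall hL fun w _ => World.of_logic h

theorem IsTenseLogic.normal_bbox (hL : IsTenseLogic L) : IsNormal L bbox where
  mono φ ψ h := by
    refine mem_imp_of_forall hL fun w hw => ?_
    simp only [bbox, World.neg_mem] at hw ⊢
    refine fun hc => hw (World.of_imp (hL.bdia_mono ?_) hc)
    refine mem_imp_of_forall hL fun u hu => ?_
    simp only [World.neg_mem] at hu ⊢
    exact fun hc => hu (World.of_imp h hc)
  and φ ψ := by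
    refine mem_imp_of_forall hL fun w hw => ?_
    simp only [bbox, World.neg_mem, World.and_mem] at hw ⊢
    intro hc
    have h : (φ.and ψ).neg.bdia.imp (φ.neg.bdia.or ψ.neg.bdia) ∈ L := by
      refine (hL.adj _ _).2 (mem_imp_of_forall hL fun u hu => ?_)
      simp only [World.neg_mem, World.and_mem, not_and_or] at hu
      rcases hu with hu | hu
      · refine World.of_imp (hL.box_mono ?_) (World.of_imp (hL.box_bdia φ.neg) (World.neg_mem.2 hu))
        exact mem_imp_of_forall hL fun v hv => World.or_mem.2 (Or.inl hv)
      · refine World.of_imp (hL.box_mono ?_) (World.of_imp (hL.box_bdia ψ.neg) (World.neg_mem.2 hu))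
        exact mem_imp_of_forall hL fun v hv => World.or_mem.2 (Or.inr hv)
    rcases World.or_mem.1 (World.of_imp h hc) with h | h
    · exact hw.1 h
    · exact hw.2 h
  nec φ h := by
    have h' : φ.neg.bdia.imp .bot ∈ L := by
      refine (hL.adj _ _).2 (mem_imp_of_forall hL fun w hw => ?_)
      exact absurd (World.of_logic h) (World.neg_mem.1 hw)
    exact h'

theorem IsNormal.exists_rel {B : Formula → Formula} (hB : IsNormal L B) (hL : IsTenseLogic L)
    {x : World L} {ψ : Formula} (h : B ψ ∉ x) : ∃ y, Rel B x y ∧ ψ ∉ y := by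
  refine World.exists_of_directed hL (D := {χ | B χ ∈ x})
    ⟨_, World.of_logic (hB.nec _ (hL.imp_self .bot))⟩ (fun χ hχ θ hθ => ?_) fun χ hχ hc => ?_
  · exact World.of_imp (hB.and χ θ) (World.and_mem.2 ⟨hχ, hθ⟩)
  · exact h (World.of_imp (hB.mono _ _ hc) hχ)

theorem IsNormal.box_mem_iff {B : Formula → Formula} (hB : IsNormal L B) (hL : IsTenseLogic L)
    {x : World L} {ψ : Formula} : B ψ ∈ x ↔ ∀ y, Rel B x y → ψ ∈ y := by
  refine ⟨fun h y hy => hy ψ h, fun h => ?_⟩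
  by_contra hc
  obtain ⟨y, hy, hy'⟩ := hB.exists_rel hL hc
  exact hy' (h y hy)

/-- The adjunction of `◆` and `□`, in the form `◆□φ → φ` and `φ → □◆φ`, makes the two canonical
relations converse to each other. -/
theorem rel_bbox_iff (hL : IsTenseLogic L) {x y : World L} : Rel bbox y x ↔ Rel box x y := by
  constructor
  · intro h φ hφ
    by_contra hc
    refine World.neg_mem.1 (h φ.box.neg (World.neg_mem.2 fun hd => hc ?_)) hφ
    refine World.of_imp (hL.bdia_box φ) (World.of_imp (hL.bdia_mono ?_) hd)
    exact mem_imp_of_forall hL fun w hw => by simpa using hw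
  · intro h φ hφ
    by_contra hc
    exact World.neg_mem.1 hφ (h _ (World.of_imp (hL.box_bdia φ.neg) (World.neg_mem.2 hc)))

theorem bdia_mem_iff (hL : IsTenseLogic L) {x : World L} {ψ : Formula} :
    ψ.bdia ∈ x ↔ ψ.neg.bbox ∉ x := by
  simp only [bbox, World.neg_mem, not_not]
  constructor <;> intro h <;> refine World.of_imp (hL.bdia_mono ?_) h <;>
    exact mem_imp_of_forall hL fun w hw => by simpa using hw

theorem bdia_mem_iff_exists (hL : IsTenseLogic L) {x : World L} {ψ : Formula} :
    ψ.bdia ∈ x ↔ ∃ y, Rel box y x ∧ ψ ∈ y := by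
  rw [bdia_mem_iff hL, hL.normal_bbox.box_mem_iff hL]
  simp [rel_bbox_iff hL]

theorem dia_mem_iff_exists (hL : IsTenseLogic L) {x : World L} {ψ : Formula} :
    ψ.dia ∈ x ↔ ∃ y, Rel box x y ∧ ψ ∈ y := by
  simp [Formula.dia, hL.normal_box.box_mem_iff hL]

end

/-! ### The canonical frame of an extension of `S4.3_t` -/

/-- `L` is a tense logic containing `S4.3_t`. -/
structure IsS43 (L : Set Formula) : Prop where
  tense : IsTenseLogic L
  sub : S43t ⊆ L

/-- The axioms of `S4.3_t`. -/
def axS43 : Set Formula :=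
  {imp (box (p 0)) (p 0), imp (box (p 0)) (box (box (p 0))), bz 1, bwForth1, bwBack1}

theorem axS43_subset : axS43 ⊆ S43t := by
  have h4 : S4t ⊆ S43t := subset_oplus_left _ _
  rintro φ (rfl | rfl | rfl | rfl | rfl)
  · exact h4 (subset_oplus_right _ _ (by simp))
  · exact h4 (subset_oplus_right _ _ (by simp))
  all_goals exact subset_oplus_right _ _ (by simp)

theorem S43t_subset {L : Set Formula} (hL : IsTenseLogic L) (h : axS43 ⊆ L) : S43t ⊆ L := by
  refine oplus_subset hL (oplus_subset hL (Kt_subset hL) ?_) ?_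
  · rintro φ (rfl | rfl) <;> exact h (by simp [axS43])
  · rintro φ (rfl | rfl | rfl) <;> exact h (by simp [axS43])

/-- Substitution for the first three variables. -/
def subst3 (φ ψ χ : Formula) : ℕ → Formula
  | 0 => φ
  | 1 => ψ
  | _ => χ

section

variable (s : ℕ → Formula) (φ ψ : Formula)

@[simp] theorem Formula.subst_p (i : ℕ) : (Formula.p i).subst s = s i := rfl
@[simp] theorem Formula.subst_bot : Formula.bot.subst s = .bot := rfl
@[simp] theorem Formula.subst_imp : (φ.imp ψ).subst s = (φ.subst s).imp (ψ.subst s) := rfl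
@[simp] theorem Formula.subst_box : φ.box.subst s = (φ.subst s).box := rfl
@[simp] theorem Formula.subst_bdia : φ.bdia.subst s = (φ.subst s).bdia := rfl
@[simp] theorem Formula.subst_neg : φ.neg.subst s = (φ.subst s).neg := rfl
@[simp] theorem Formula.subst_and : (φ.and ψ).subst s = (φ.subst s).and (ψ.subst s) := rfl
@[simp] theorem Formula.subst_or : (φ.or ψ).subst s = (φ.subst s).or (ψ.subst s) := rfl
@[simp] theorem Formula.subst_dia : φ.dia.subst s = (φ.subst s).dia := rfl
@[simp] theorem subst3_zero (χ : Formula) : subst3 φ ψ χ 0 = φ := rfl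
@[simp] theorem subst3_one (χ : Formula) : subst3 φ ψ χ 1 = ψ := rfl

end

theorem World.subst_mem {L : Set Formula} (hL : IsTenseLogic L) {φ : Formula} (hφ : φ ∈ L)
    (s : ℕ → Formula) (w : World L) : φ.subst s ∈ w :=
  World.of_logic (hL.subst_mem φ s hφ)

section

variable {L : Set Formula}

/-- The relation of the canonical frame. -/
abbrev World.R (x y : World L) : Prop := Rel box x y

/-- `x` and `y` lie in the same component. -/
def Comp (x y : World L) : Prop := x.R y ∨ y.R x

theorem Comp.symm {x y : World L} (h : Comp x y) : Comp y x := Or.symm h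

variable (h : IsS43 L)
include h

theorem IsS43.ax_mem {φ : Formula} (hφ : φ ∈ axS43) (s : ℕ → Formula) (w : World L) :
    φ.subst s ∈ w :=
  World.subst_mem h.tense (h.sub (axS43_subset hφ)) s w

theorem IsS43.refl (x : World L) : x.R x := fun φ hφ => by
  have := h.ax_mem (φ := imp (box (p 0)) (p 0)) (by simp [axS43]) (subst3 φ φ φ) x
  simp only [subst_imp, subst_box, subst_p, subst3_zero, World.imp_mem] at this
  exact this hφ

theorem IsS43.trans {x y z : World L} (hxy : x.R y) (hyz : y.R z) : x.R z := fun φ hφ => by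
  have := h.ax_mem (φ := imp (box (p 0)) (box (box (p 0)))) (by simp [axS43]) (subst3 φ φ φ) x
  simp only [subst_imp, subst_box, subst_p, subst3_zero, World.imp_mem] at this
  exact hyz φ (hxy _ (this hφ))

/-- If `y` and `z` are incomparable, pick `α` with `□α ∈ y`, `α ∉ z` and `β` with `□β ∈ z`, `β ∉ y`.
The axiom for `□α ∧ ¬β` and `□β ∧ ¬α` provides a world satisfying one of them that sees, or is, a
world satisfying the other, which is impossible. -/
theorem IsS43.total_forth {x y z : World L} (hxy : x.R y) (hxz : x.R z) : y.R z ∨ z.R y := by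
  by_contra hc
  simp only [Rel, not_or, not_forall] at hc
  obtain ⟨⟨α, hα, hα'⟩, β, hβ, hβ'⟩ := hc
  have := h.ax_mem (φ := bwForth1) (by simp [axS43])
    (subst3 (α.box.and β.neg) (β.box.and α.neg) .bot) x
  simp only [bwForth1, subst_imp, subst_and, subst_or, subst_dia, subst_p, subst3_zero, subst3_one,
    World.imp_mem, World.and_mem, World.or_mem, World.neg_mem,
    dia_mem_iff_exists h.tense] at this
  rcases this ⟨⟨y, hxy, hα, hβ'⟩, z, hxz, hβ, hα'⟩ with
    ⟨u, -, ⟨h1, h2⟩, ⟨h3, h4⟩ | ⟨v, huv, h3, h4⟩⟩ | ⟨u, -, ⟨h1, h2⟩, ⟨h3, h4⟩ | ⟨v, huv, h3, h4⟩⟩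
  · exact h4 (h.refl u _ h1)
  · exact h4 (huv _ h1)
  · exact h4 (h.refl u _ h1)
  · exact h4 (huv _ h1)

theorem IsS43.total_back {x y z : World L} (hyx : y.R x) (hzx : z.R x) : y.R z ∨ z.R y := by
  by_contra hc
  rw [World.R, World.R, ← rel_bbox_iff h.tense, ← rel_bbox_iff h.tense] at hc
  simp only [Rel, not_or, not_forall] at hc
  obtain ⟨⟨α, hα, hα'⟩, β, hβ, hβ'⟩ := hc
  have := h.ax_mem (φ := bwBack1) (by simp [axS43])
    (subst3 (α.bbox.and β.neg) (β.bbox.and α.neg) .bot) x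
  simp only [bwBack1, subst_imp, subst_and, subst_or, subst_bdia, subst_p, subst3_zero, subst3_one,
    World.imp_mem, World.and_mem, World.or_mem, World.neg_mem,
    bdia_mem_iff_exists h.tense, ← rel_bbox_iff h.tense] at this
  have hrefl : ∀ u : World L, Rel bbox u u := fun u => (rel_bbox_iff h.tense).2 (h.refl u)
  rcases this ⟨⟨z, (rel_bbox_iff h.tense).2 hzx, hα, hβ'⟩, y, (rel_bbox_iff h.tense).2 hyx, hβ, hα'⟩
    with ⟨u, -, ⟨h1, h2⟩, ⟨h3, h4⟩ | ⟨v, huv, h3, h4⟩⟩ | ⟨u, -, ⟨h1, h2⟩, ⟨h3, h4⟩ | ⟨v, huv, h3, h4⟩⟩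
  · exact h4 (hrefl u _ h1)
  · exact h4 (huv _ h1)
  · exact h4 (hrefl u _ h1)
  · exact h4 (huv _ h1)

theorem IsS43.comp_refl (x : World L) : Comp x x := Or.inl (h.refl x)

/-- Worlds with a common successor or a common predecessor are comparable, so zigzags never leave
the set of worlds comparable to a given one. Components are thus equivalence classes, each totally
preordered. -/
theorem IsS43.comp_trans {x y z : World L} (hxy : Comp x y) (hyz : Comp y z) : Comp x z := by
  rcases hxy with hxy | hxy <;> rcases hyz with hyz | hyz
  · exact Or.inl (h.trans hxy hyz)
  · exact h.total_back hxy hyz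
  · exact h.total_forth hxy hyz
  · exact Or.inr (h.trans hyz hxy)

theorem IsS43.comp_rel {x y z : World L} (hxy : Comp x y) (hyz : y.R z) : Comp x z :=
  h.comp_trans hxy (Or.inl hyz)

theorem IsS43.comp_rel' {x y z : World L} (hxy : Comp x y) (hzy : z.R y) : Comp x z :=
  h.comp_trans hxy (Or.inr hzy)

theorem IsS43.total {x y z : World L} (hxy : Comp x y) (hxz : Comp x z) : y.R z ∨ z.R y :=
  h.comp_trans hxy.symm hxz

end

/-! ### Validity via finite quotients with definable fibres -/

/-- The set `S` is defined by a formula in the component of `x`. -/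
def DefIn {L : Set Formula} (x : World L) (S : Set (World L)) : Prop :=
  ∃ χ : Formula, ∀ y, Comp x y → (χ ∈ y ↔ y ∈ S)

namespace DefIn

variable {L : Set Formula} {x : World L} {S T : Set (World L)}

theorem mem (χ : Formula) : DefIn x {y | χ ∈ y} := ⟨χ, fun _ _ => Iff.rfl⟩

theorem compl (hS : DefIn x S) : DefIn x Sᶜ := by
  obtain ⟨χ, hχ⟩ := hS
  exact ⟨χ.neg, fun y hy => by simp [hχ y hy]⟩

theorem inter (hS : DefIn x S) (hT : DefIn x T) : DefIn x (S ∩ T) := by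
  obtain ⟨χ, hχ⟩ := hS
  obtain ⟨θ, hθ⟩ := hT
  exact ⟨χ.and θ, fun y hy => by simp [hχ y hy, hθ y hy]⟩

theorem union (hS : DefIn x S) (hT : DefIn x T) : DefIn x (S ∪ T) := by
  obtain ⟨χ, hχ⟩ := hS
  obtain ⟨θ, hθ⟩ := hT
  exact ⟨χ.or θ, fun y hy => by simp [hχ y hy, hθ y hy]⟩

theorem const (a : Prop) : DefIn x {_y | a} := by
  by_cases ha : a
  · exact ⟨Formula.bot.imp .bot, fun y _ => by simp [ha]⟩
  · exact ⟨.bot, fun y _ => by simp [ha]⟩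

theorem congr (hS : DefIn x S) (h : ∀ y, Comp x y → (y ∈ S ↔ y ∈ T)) : DefIn x T := by
  obtain ⟨χ, hχ⟩ := hS
  exact ⟨χ, fun y hy => (hχ y hy).trans (h y hy)⟩

theorem biInter {ι : Type*} (s : Finset ι) {U : ι → Set (World L)} (hU : ∀ i ∈ s, DefIn x (U i)) :
    DefIn x {y | ∀ i ∈ s, y ∈ U i} := by
  classical
  induction s using Finset.induction_on with
  | empty => simpa using const True
  | insert a s _ ih =>
    refine ((hU a (by simp)).inter (ih fun i hi => hU i (by simp [hi]))).congr fun y _ => ?_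
    simp

theorem biUnion {ι : Type*} (s : Finset ι) {U : ι → Set (World L)} (hU : ∀ i ∈ s, DefIn x (U i)) :
    DefIn x {y | ∃ i ∈ s, y ∈ U i} :=
  (biInter s (fun i hi => (hU i hi).compl)).compl.congr fun y _ => by simp

theorem ite {α : Type*} {S : Set (World L)} [DecidablePred (· ∈ S)] {f g : World L → α} {a : α}
    (hS : DefIn x S) (hf : DefIn x {y | f y = a}) (hg : DefIn x {y | g y = a}) :
    DefIn x {y | (if y ∈ S then f y else g y) = a} := by
  refine ((hS.inter hf).union (hS.compl.inter hg)).congr fun y _ => ?_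
  by_cases hy : y ∈ S <;> simp [hy]

/-- Any finite nonempty set of worlds is a retract with definable fibres. -/
theorem exists_retract (x : World L) (T : Finset (World L)) (hT : T.Nonempty) :
    ∃ g : World L → World L, (∀ c ∈ T, g c = c) ∧ (∀ z, g z ∈ T) ∧
      ∀ c, DefIn x {z | g z = c} := by
  classical
  induction hT using Finset.Nonempty.cons_induction with
  | singleton a => exact ⟨fun _ => a, by simp, by simp, fun c => const _⟩
  | cons a s ha hs ih =>
    obtain ⟨g, h1, h2, h3⟩ := ih
    have hsep : ∀ c : World L, ∃ δ : Formula, c ∈ s → δ ∈ a ∧ δ ∉ c := by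
      intro c
      by_cases hc : c ∈ s
      · obtain ⟨δ, hδ⟩ := World.exists_of_ne (w := a) (u := c) (by rintro rfl; exact ha hc)
        exact ⟨δ, fun _ => hδ⟩
      · exact ⟨.bot, fun h => absurd h hc⟩
    choose δ hδ using hsep
    -- A definable set that contains `a` and no point of `s`: send it to `a` and leave the rest to
    -- the earlier retraction.
    let S : Set (World L) := {y | ∀ c ∈ s, y ∈ {y | δ c ∈ y}}
    refine ⟨fun z => if z ∈ S then a else g z, ?_, ?_, ?_⟩
    · intro c hc
      rcases Finset.mem_cons.1 hc with rfl | hc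
      · exact if_pos fun c hc => (hδ c hc).1
      · exact (if_neg fun hS : c ∈ S => (hδ c hc).2 (hS c hc)).trans (h1 c hc)
    · intro z
      dsimp only
      split_ifs
      · simp
      · simp [h2 z]
    · intro c
      exact DefIn.ite (f := fun _ => a) (biInter s fun c _ => mem (δ c)) (const _) (h3 c)

end DefIn

/-- A bounded morphism from a component of the canonical frame onto a finite frame whose fibres
are definable transfers validity. -/
theorem valid_of_definable_morphism {L : Set Formula} (h : IsS43 L) {F : KFrame} [Finite F.X]
    {x : World L} (f : World L → F.X) (hdef : ∀ a, DefIn x {y | f y = a})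
    (hmono : ∀ y z, Comp x y → y.R z → F.R (f y) (f z))
    (hforth : ∀ y a, Comp x y → F.R (f y) a → ∃ z, y.R z ∧ f z = a)
    (hback : ∀ y a, Comp x y → F.R a (f y) → ∃ z, z.R y ∧ f z = a)
    (hsurj : ∀ a, ∃ y, Comp x y ∧ f y = a) {φ : Formula} (hφ : φ ∈ L) : F.Valid φ := by
  classical
  have := Fintype.ofFinite F.X
  intro V a
  -- A formula defining the preimage of `V i` is substituted for `p i`; this turns a valuation on
  -- `F` into a substitution, under which `L` is closed.
  have hs : ∀ i, DefIn x {y | f y ∈ V i} := fun i =>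
    (DefIn.biUnion (Finset.univ.filter (· ∈ V i)) (fun a _ => hdef a)).congr fun y _ => by simp
  choose s hs using hs
  have key : ∀ (ψ : Formula) (y : World L), Comp x y → (F.Sat V (f y) ψ ↔ ψ.subst s ∈ y) := by
    intro ψ
    induction ψ with
    | p i => exact fun y hy => (hs i y hy).symm
    | bot => simp
    | imp φ ψ h1 h2 => intro y hy; simp [h1 y hy, h2 y hy]
    | box φ ih =>
      intro y hy
      rw [KFrame.sat_box, subst_box, h.tense.normal_box.box_mem_iff h.tense]
      constructor
      · intro hb z hz
        exact (ih z (h.comp_rel hy hz)).1 (hb _ (hmono y z hy hz))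
      · intro hb b hb'
        obtain ⟨z, hz, rfl⟩ := hforth y b hy hb'
        exact (ih z (h.comp_rel hy hz)).2 (hb z hz)
    | bdia φ ih =>
      intro y hy
      rw [KFrame.sat_bdia, subst_bdia, bdia_mem_iff_exists h.tense]
      constructor
      · rintro ⟨b, hb', hb⟩
        obtain ⟨z, hz, rfl⟩ := hback y b hy hb'
        exact ⟨z, hz, (ih z (h.comp_rel' hy hz)).1 hb⟩
      · rintro ⟨z, hz, hb⟩
        have hxz := h.comp_rel' hy hz
        exact ⟨f z, hmono z y hxz hz, (ih z hxz).2 hb⟩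
  obtain ⟨y, hy, rfl⟩ := hsurj a
  exact (key φ y hy).2 (World.subst_mem h.tense hφ s y)

/-! ### Refutation on frames mapped into the canonical frame -/

open Classical in
/-- The set of subformulas. -/
noncomputable def Formula.sub : Formula → Finset Formula
  | p i => {p i}
  | bot => {bot}
  | imp φ ψ => insert (imp φ ψ) (sub φ ∪ sub ψ)
  | box φ => insert (box φ) (sub φ)
  | bdia φ => insert (bdia φ) (sub φ)

theorem Formula.self_mem_sub (φ : Formula) : φ ∈ φ.sub := by
  cases φ <;> simp [Formula.sub]

/-- Allows the size of a countermodel to be computed directly from the Gödel number. -/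
theorem Formula.card_sub_le (φ : Formula) : φ.sub.card ≤ φ.code + 1 := by
  classical
  induction φ with
  | p i => simp [Formula.sub]
  | bot => simp [Formula.sub]
  | imp φ ψ h1 h2 =>
    have := Nat.add_le_pair φ.code ψ.code
    have h3 := Finset.card_insert_le (imp φ ψ) (φ.sub ∪ ψ.sub)
    have h4 := Finset.card_union_le φ.sub ψ.sub
    simp only [Formula.sub, Formula.code]
    omega
  | box φ h =>
    have h3 := Finset.card_insert_le (box φ) φ.sub
    simp only [Formula.sub, Formula.code]
    omega
  | bdia φ h =>
    have h3 := Finset.card_insert_le (bdia φ) φ.sub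
    simp only [Formula.sub, Formula.code]
    omega

/-- A monotone map of a frame into the canonical frame with enough witnesses for the modal
formulas in `S` preserves the truth of formulas with all subformulas in `S`. -/
theorem sat_iff_mem {L : Set Formula} (hL : IsTenseLogic L) {F : KFrame} (g : F.X → World L)
    (S : Finset Formula) (hmono : ∀ a b, F.R a b → (g a).R (g b))
    (hforth : ∀ a, ∀ ψ ∈ S, ∀ z, (g a).R z → ψ ∉ z → ∃ b, F.R a b ∧ ψ ∉ g b)
    (hback : ∀ a, ∀ ψ ∈ S, ∀ z : World L, z.R (g a) → ψ ∈ z → ∃ b, F.R b a ∧ ψ ∈ g b)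
    (φ : Formula) (hφ : φ.sub ⊆ S) (a : F.X) :
    F.Sat (fun i => {b | Formula.p i ∈ g b}) a φ ↔ φ ∈ g a := by
  classical
  induction φ generalizing a with
  | p i => rfl
  | bot => simp
  | imp φ ψ h1 h2 =>
    have h3 : φ.sub ⊆ S := fun χ hχ => hφ (by simp [Formula.sub, hχ])
    have h4 : ψ.sub ⊆ S := fun χ hχ => hφ (by simp [Formula.sub, hχ])
    simp [h1 h3, h2 h4]
  | box φ ih =>
    have h3 : φ.sub ⊆ S := fun χ hχ => hφ (by simp [Formula.sub, hχ])
    rw [KFrame.sat_box, hL.normal_box.box_mem_iff hL]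
    constructor
    · intro hb z hz
      by_contra hc
      obtain ⟨b, hab, hb'⟩ := hforth a φ (h3 φ.self_mem_sub) z hz hc
      exact hb' ((ih h3 b).1 (hb b hab))
    · exact fun hb b hab => (ih h3 b).2 (hb _ (hmono a b hab))
  | bdia φ ih =>
    have h3 : φ.sub ⊆ S := fun χ hχ => hφ (by simp [Formula.sub, hχ])
    rw [KFrame.sat_bdia, bdia_mem_iff_exists hL]
    constructor
    · rintro ⟨b, hab, hb⟩
      exact ⟨g b, hmono b a hab, (ih h3 b).1 hb⟩
    · rintro ⟨z, hz, hb⟩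
      obtain ⟨b, hab, hb'⟩ := hback a φ (h3 φ.self_mem_sub) z hz hb
      exact ⟨b, hab, (ih h3 b).2 hb'⟩

/-! ### The five families of finite frames -/

/-- The types of the families: finite chains, and clusters of unbounded size, possibly with a
single point below (`b`) and a single point above (`t`). -/
inductive FrameType
  | chain
  | cluster (b t : Bool)

/-- The relation on `ℕ` whose restrictions to initial segments form the family. In the frames with
a cluster, `0` is the point below and `1` is the point above. -/
def FrameType.rel : FrameType → ℕ → ℕ → Prop
  | chain, i, j => i ≤ j
  | cluster b t, i, j => (b = true → j = 0 → i = 0) ∧ (t = true → i = 1 → j = 1)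

/-- The member of the family with `n + 1` points. -/
def FrameType.frame (τ : FrameType) (n : ℕ) : KFrame where
  X := Fin (n + 1)
  nonempty := ⟨0⟩
  R i j := τ.rel i j

instance (τ : FrameType) (n : ℕ) : Finite (τ.frame n).X := inferInstanceAs (Finite (Fin (n + 1)))

/-- The frames of the family with at least three points. -/
def FrameType.family (τ : FrameType) : Set KFrame := {F | ∃ n, 2 ≤ n ∧ F = τ.frame n}

theorem mem_Log_family {τ : FrameType} {φ : Formula} :
    φ ∈ Log τ.family ↔ ∀ n, 2 ≤ n → (τ.frame n).Valid φ := by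
  constructor
  · exact fun h n hn => h _ ⟨n, hn, rfl⟩
  · rintro h _ ⟨n, hn, rfl⟩
    exact h n hn

theorem FrameType.rel_zero (τ : FrameType) (j : ℕ) : τ.rel 0 j := by
  cases τ <;> simp [FrameType.rel]

theorem isConsistent_Log_family (τ : FrameType) : IsConsistent (Log τ.family) :=
  isConsistent_Log ⟨_, 2, le_rfl, rfl⟩

/-- Conjunction of a list of formulas. -/
def conj : List Formula → Formula
  | [] => Formula.bot.imp .bot
  | φ :: l => φ.and (conj l)

theorem sat_conj {F : KFrame} {V : ℕ → Set F.X} {x : F.X} {l : List Formula} :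
    F.Sat V x (conj l) ↔ ∀ φ ∈ l, F.Sat V x φ := by
  induction l with
  | nil => simp [conj]
  | cons φ l ih => simp [conj, ih]

/-- No point has more than `N` successors. -/
def alt (N : ℕ) : Formula :=
  neg (conj ((List.range (N + 1)).map fun i =>
    dia ((p i).and (conj ((List.range i).map fun j => neg (p j))))))

theorem sat_alt {F : KFrame} {V : ℕ → Set F.X} {x : F.X} {N : ℕ} :
    F.Sat V x (alt N) ↔
      ¬ ∀ i < N + 1, ∃ y, F.R x y ∧ y ∈ V i ∧ ∀ j < i, y ∉ V j := by
  simp [alt, sat_conj]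

theorem valid_alt (F : KFrame) [Finite F.X] : F.Valid (alt (Nat.card F.X)) := by
  intro V x
  rw [sat_alt]
  intro h
  have := F.nonempty
  choose! y hy using h
  -- `y i` lies in `V i` but in no earlier `V j`, so the witnesses are distinct and outnumber the
  -- points.
  have hinj : Function.Injective fun i : Fin (Nat.card F.X + 1) => y i := by
    intro i j hij
    by_contra hne
    rcases lt_or_gt_of_ne hne with hlt | hlt
    · exact (hy j j.2).2.2 i hlt (by simpa [← hij] using (hy i i.2).2.1)
    · exact (hy i i.2).2.2 j hlt (by simpa [hij] using (hy j j.2).2.1)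
  have := Nat.card_le_card_of_injective _ hinj
  simp at this

/-- The logic of a finite frame contains some `alt N`, whereas the point `0` of each member sees all
points, and their number is unbounded. -/
theorem not_isTabular_Log_family (τ : FrameType) : ¬ IsTabular (Log τ.family) := by
  rintro ⟨F, hF, h⟩
  set N := Nat.card F.X
  have h1 : alt N ∈ Log τ.family := by
    rw [h]
    rintro G hG
    obtain rfl := Set.mem_singleton_iff.1 hG
    exact valid_alt G
  have h2 := mem_Log_family.1 h1 (N + 2) (by omega) (fun i => {x : Fin (N + 3) | x.val = i})
    (0 : Fin (N + 3))
  refine sat_alt.1 h2 fun i hi => ⟨⟨i, by omega⟩, ?_, rfl, fun j hj hc => ?_⟩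
  · exact τ.rel_zero i
  · exact absurd hc (Nat.ne_of_gt hj)

/-! ### Axioms of the families -/

@[simp] theorem KFrame.sat_bbox {F : KFrame} {V : ℕ → Set F.X} {x : F.X} {φ : Formula} :
    F.Sat V x φ.bbox ↔ ∀ y, F.R y x → F.Sat V y φ := by
  simp [bbox]

/-- Grzegorczyk's axiom for `B`: `p` has a last interval. -/
def grz (B : Formula → Formula) : Formula :=
  imp (p 0) (neg (B (neg (and (p 0) (B (imp (neg (p 0)) (B (neg (p 0)))))))))

/-- McKinsey's axiom for `B`. -/
def mck (B : Formula → Formula) : Formula :=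
  imp (B (neg (B (neg (p 0))))) (neg (B (neg (B (p 0)))))

/-- Any two points `y`, `x` satisfy `R x y`, unless `b` and `y` is an isolated bottom, or `t` and `x`
is an isolated top. -/
def midCluster (b t : Bool) : Formula :=
  imp (and (box (p 0)) (if t then and (p 2) (dia (neg (p 2))) else imp bot bot))
    (bbox (imp (if b then and (p 1) (bdia (neg (p 1))) else imp bot bot) (p 0)))

/-- The axioms of a family over `S4.3_t`. -/
def FrameType.axioms : FrameType → Set Formula
  | chain => {grz box, grz bbox}
  | cluster b t => {midCluster b t, if b then mck bbox else imp bot bot,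
      if t then mck box else imp bot bot}

theorem FrameType.axioms_finite (τ : FrameType) : τ.axioms.Finite := by
  cases τ <;> simp [FrameType.axioms]

/-- Take `y` maximal among the points above `x` where `p` holds. A point above `y` refuting `p`
cannot see `p` again: maximality would place it back at `y`. -/
theorem valid_grz_box {F : KFrame} [Finite F.X] (hr : ∀ x, F.R x x)
    (ht : ∀ x y z, F.R x y → F.R y z → F.R x z) (ha : ∀ x y, F.R x y → F.R y x → x = y) :
    F.Valid (grz box) := by
  let _ : PartialOrder F.X := { le := F.R, le_refl := hr, le_trans := ht, le_antisymm := ha }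
  intro V x hx
  obtain ⟨y, ⟨hy, hxy⟩, hmax⟩ := Set.Finite.exists_maximal
    (s := {y : F.X | y ∈ V 0 ∧ x ≤ y}) (Set.toFinite _) ⟨x, hx, le_rfl⟩
  rw [KFrame.sat_neg, KFrame.sat_box]
  intro h
  refine h y hxy (KFrame.sat_and.2 ⟨hy, ?_⟩)
  intro z (hyz : y ≤ z) hz u (hzu : z ≤ u) hu
  have hzy : z ≤ y := hzu.trans (hmax ⟨hu, hxy.trans (hyz.trans hzu)⟩ (hyz.trans hzu))
  obtain rfl := le_antisymm hzy hyz
  exact hz hy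

theorem valid_grz_bbox {F : KFrame} [Finite F.X] (hr : ∀ x, F.R x x)
    (ht : ∀ x y z, F.R x y → F.R y z → F.R x z) (ha : ∀ x y, F.R x y → F.R y x → x = y) :
    F.Valid (grz bbox) := by
  let _ : PartialOrder F.X := { le := F.R, le_refl := hr, le_trans := ht, le_antisymm := ha }
  intro V x hx
  obtain ⟨y, ⟨hy, hxy⟩, hmin⟩ := Set.Finite.exists_minimal
    (s := {y : F.X | y ∈ V 0 ∧ y ≤ x}) (Set.toFinite _) ⟨x, hx, le_rfl⟩
  rw [KFrame.sat_neg, KFrame.sat_bbox]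
  intro h
  refine h y hxy (KFrame.sat_and.2 ⟨hy, KFrame.sat_bbox.2 ?_⟩)
  intro z (hyz : z ≤ y) hz
  rw [KFrame.sat_bbox]
  intro u (hzu : u ≤ z) hu
  have hzy : y ≤ z := (hmin ⟨hu, (hzu.trans hyz).trans hxy⟩ (hzu.trans hyz)).trans hzu
  obtain rfl := le_antisymm hzy hyz
  exact hz hy

theorem valid_midCluster {F : KFrame} {b t : Bool}
    (h : ∀ x y, F.R x y ∨ (b = true ∧ ∀ z, F.R z y → z = y) ∨ (t = true ∧ ∀ z, F.R x z → z = x)) :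
    F.Valid (midCluster b t) := by
  intro V x
  unfold midCluster
  rw [KFrame.sat_imp, KFrame.sat_bbox, KFrame.sat_and]
  intro ⟨hx, ht⟩ y _ hb
  rcases h x y with h' | ⟨rfl, h'⟩ | ⟨rfl, h'⟩
  · exact hx y h'
  · simp only [if_true, KFrame.sat_and, KFrame.sat_bdia] at hb
    obtain ⟨h1, z, hz, h2⟩ := hb
    exact absurd h1 (h' z hz ▸ h2)
  · simp only [if_true, KFrame.sat_and, KFrame.sat_dia] at ht
    obtain ⟨h1, z, hz, h2⟩ := ht
    exact absurd h1 (h' z hz ▸ h2)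

/-- Every point has `o` below it, and `o` has only itself below, so at `o` either `p` or `¬p` is
settled for good. -/
theorem valid_mck_bbox {F : KFrame} (o : F.X) (h0 : ∀ y, F.R o y) (h1 : ∀ y, F.R y o → y = o) :
    F.Valid (mck bbox) := by
  intro V x
  simp only [mck, KFrame.sat_imp, KFrame.sat_bbox, KFrame.sat_neg, not_forall, not_not]
  intro h
  obtain ⟨y, hy, hy'⟩ := h o (h0 x)
  refine ⟨o, h0 x, ?_⟩
  rintro ⟨z, hz, hc⟩
  rw [h1 y hy] at hy'
  rw [h1 z hz] at hc
  exact hc hy'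

theorem valid_mck_box {F : KFrame} (o : F.X) (h0 : ∀ y, F.R y o) (h1 : ∀ y, F.R o y → y = o) :
    F.Valid (mck box) := by
  intro V x
  simp only [mck, KFrame.sat_imp, KFrame.sat_box, KFrame.sat_neg, not_forall, not_not]
  intro h
  obtain ⟨y, hy, hy'⟩ := h o (h0 x)
  refine ⟨o, h0 x, ?_⟩
  rintro ⟨z, hz, hc⟩
  rw [h1 y hy] at hy'
  rw [h1 z hz] at hc
  exact hc hy'

theorem FrameType.axioms_subset (τ : FrameType) : τ.axioms ⊆ Log τ.family := by
  intro φ hφ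
  rw [mem_Log_family]
  intro n hn
  have htop : ∀ F : KFrame, F.Valid (imp bot bot) := fun F V x h => h
  cases τ with
  | chain =>
    have hr (x : Fin (n + 1)) : x.val ≤ x := le_rfl
    have ht (x y z : Fin (n + 1)) (h : x.val ≤ y) (h' : y.val ≤ z) : x.val ≤ z := h.trans h'
    have ha (x y : Fin (n + 1)) (h : x.val ≤ y) (h' : y.val ≤ x) : x = y :=
      Fin.ext (le_antisymm h h')
    rcases hφ with rfl | rfl
    · exact valid_grz_box hr ht ha
    · exact valid_grz_bbox hr ht ha
  | cluster b t =>
    rcases hφ with rfl | rfl | rfl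
    · refine valid_midCluster fun (x y : Fin (n + 1)) => ?_
      by_cases hb : b = true ∧ y.val = 0
      · exact Or.inr (Or.inl ⟨hb.1, fun z hz => Fin.ext ((hz.1 hb.1 hb.2).trans hb.2.symm)⟩)
      by_cases ht : t = true ∧ x.val = 1
      · exact Or.inr (Or.inr ⟨ht.1, fun z hz => Fin.ext ((hz.2 ht.1 ht.2).trans ht.2.symm)⟩)
      exact Or.inl ⟨fun h h' => absurd ⟨h, h'⟩ hb, fun h h' => absurd ⟨h, h'⟩ ht⟩
    · cases b
      · exact htop _
      · exact valid_mck_bbox (F := (cluster true t).frame n) (0 : Fin (n + 1))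
          (fun y => (cluster true t).rel_zero _) (fun y hy => Fin.ext (hy.1 rfl rfl))
    · cases t
      · exact htop _
      · exact valid_mck_box (F := (cluster b true).frame n) (⟨1, by omega⟩ : Fin (n + 1))
          (fun y => ⟨fun _ h => absurd h one_ne_zero, fun _ _ => rfl⟩)
          (fun y hy => Fin.ext (hy.2 rfl rfl))

/-! ### Finite subsets of total preorders -/

theorem Finset.exists_least_of_total {α : Type*} {r : α → α → Prop}
    (htrans : ∀ a b c, r a b → r b c → r a c) (s : Finset α) (hs : s.Nonempty)
    (htot : ∀ a ∈ s, ∀ b ∈ s, r a b ∨ r b a) : ∃ m ∈ s, ∀ a ∈ s, r m a := by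
  classical
  induction hs using Finset.Nonempty.cons_induction with
  | singleton a =>
    exact ⟨a, by simp, fun b hb => by
      obtain rfl := Finset.mem_singleton.1 hb
      exact or_self_iff.1 (htot b hb b hb)⟩
  | cons a s ha hs ih =>
    obtain ⟨m, hm, h⟩ := ih fun b hb c hc => htot b (by simp [hb]) c (by simp [hc])
    rcases htot a (by simp) m (by simp [hm]) with h' | h'
    · refine ⟨a, by simp, fun b hb => ?_⟩
      rcases Finset.mem_cons.1 hb with rfl | hb
      · exact or_self_iff.1 (htot b (by simp) b (by simp))
      · exact htrans _ _ _ h' (h b hb)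
    · refine ⟨m, by simp [hm], fun b hb => ?_⟩
      rcases Finset.mem_cons.1 hb with rfl | hb
      · exact h'
      · exact h b hb

theorem Finset.exists_sorted_of_total {α : Type*} {r : α → α → Prop}
    (htrans : ∀ a b c, r a b → r b c → r a c) (s : Finset α)
    (htot : ∀ a ∈ s, ∀ b ∈ s, r a b ∨ r b a) :
    ∃ l : List α, l.Pairwise r ∧ (∀ a, a ∈ l ↔ a ∈ s) ∧ l.length = s.card := by
  classical
  induction hn : s.card generalizing s with
  | zero =>
    obtain rfl := Finset.card_eq_zero.1 hn
    exact ⟨[], by simp⟩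
  | succ n ih =>
    obtain ⟨m, hm, h⟩ := Finset.exists_least_of_total htrans s
      (Finset.card_pos.1 (by omega)) htot
    obtain ⟨l, h1, h2, h3⟩ := ih (s.erase m)
      (fun a ha b hb => htot a (Finset.mem_of_mem_erase ha) b (Finset.mem_of_mem_erase hb))
      (by rw [Finset.card_erase_of_mem hm]; omega)
    refine ⟨m :: l, List.pairwise_cons.2 ⟨fun a ha => h a ?_, h1⟩, fun a => ?_, by simp [h3]⟩
    · exact Finset.mem_of_mem_erase ((h2 a).1 ha)
    · rw [List.mem_cons, h2, Finset.mem_erase]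
      constructor
      · rintro (rfl | ⟨-, ha⟩) <;> assumption
      · intro ha
        by_cases hc : a = m
        · exact Or.inl hc
        · exact Or.inr ⟨hc, ha⟩

/-! ### The two necessity operators of an extension of `S4.3_t` -/

/-- The properties shared by the future and the past box. -/
structure IsS43Op (L : Set Formula) (B : Formula → Formula) : Prop where
  normal : IsNormal L B
  refl : ∀ x : World L, Rel B x x
  trans : ∀ x y z : World L, Rel B x y → Rel B y z → Rel B x z
  comp_iff : ∀ x y : World L, Comp x y ↔ Rel B x y ∨ Rel B y x
  subst : ∀ (s : ℕ → Formula) (φ : Formula), (B φ).subst s = B (φ.subst s)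

section

variable {L : Set Formula} (h : IsS43 L)
include h

theorem IsS43.op_box : IsS43Op L box where
  normal := h.tense.normal_box
  refl := h.refl
  trans _ _ _ := h.trans
  comp_iff _ _ := Iff.rfl
  subst _ _ := rfl

theorem IsS43.op_bbox : IsS43Op L bbox where
  normal := h.tense.normal_bbox
  refl x := (rel_bbox_iff h.tense).2 (h.refl x)
  trans x y z := by
    rw [rel_bbox_iff h.tense, rel_bbox_iff h.tense, rel_bbox_iff h.tense]
    exact fun h1 h2 => h.trans h2 h1
  comp_iff x y := by
    rw [rel_bbox_iff h.tense, rel_bbox_iff h.tense]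
    exact or_comm
  subst _ _ := rfl

variable {B : Formula → Formula} (hB : IsS43Op L B)
include hB

/-- If `ψ` fails somewhere in the component, there is a last cluster on which `ψ` fails, and `ψ`
fails throughout this cluster. -/
theorem IsS43Op.exists_last (hg : grz B ∈ L) {x y₀ : World L} (hy₀ : Comp x y₀) {ψ : Formula}
    (hψ : ψ ∉ y₀) : ∃ m, Comp x m ∧ (∀ z, Rel B m z → Rel B z m → ψ ∉ z) ∧
      ∀ y, Comp x y → B ψ ∉ y → Rel B y m := by
  have hT : ∀ (w : World L) (χ : Formula), B χ ∈ w → χ ∈ w := fun w χ => hB.refl w χ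
  have hbox := fun (w : World L) (χ : Formula) =>
    hB.normal.box_mem_iff h.tense (x := w) (ψ := χ)
  -- `m₀` omits `ψ` and is `B`-accessible from every `y` of the component with `B ψ ∉ y`. The
  -- formulas it must contain are closed under conjunction because the component is totally
  -- preordered.
  obtain ⟨m₀, hm₀, hm₀'⟩ := World.exists_of_directed h.tense
    (D := {χ | ∃ y, Comp x y ∧ B ψ ∉ y ∧ B χ ∈ y}) (ψ := ψ)
    ⟨_, y₀, hy₀, fun hc => hψ (hT _ _ hc),
      World.of_logic (hB.normal.nec _ (h.tense.imp_self .bot))⟩ (by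
    rintro χ ⟨y, hy, hy1, hy2⟩ θ ⟨z, hz, hz1, hz2⟩
    rcases (hB.comp_iff y z).1 (h.comp_trans hy.symm hz) with hr | hr
    · refine ⟨z, hz, hz1, (hbox _ _).2 fun u hu => World.and_mem.2 ⟨?_, hu _ hz2⟩⟩
      exact hB.trans _ _ _ hr hu _ hy2
    · refine ⟨y, hy, hy1, (hbox _ _).2 fun u hu => World.and_mem.2 ⟨hu _ hy2, ?_⟩⟩
      exact hB.trans _ _ _ hr hu _ hz2) (by
    rintro χ ⟨y, hy, hy1, hy2⟩ hc
    exact hy1 (World.of_imp (hB.normal.mono _ _ hc) hy2))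
  -- Grzegorczyk's axiom for `¬ψ` gives `u` beyond `m₀` refuting `ψ` such that, from `u` on, once
  -- `ψ` holds it persists. Then `ψ` cannot hold anywhere in the cluster of `u`, since it would come
  -- back to `u`.
  have hax := World.subst_mem h.tense hg (subst3 ψ.neg .bot .bot) m₀
  simp only [grz, subst_imp, subst_neg, subst_and, hB.subst, subst_p, subst3_zero, World.imp_mem,
    World.neg_mem] at hax
  replace hax := hax hm₀'
  rw [hbox] at hax
  push Not at hax
  obtain ⟨u, hmu, hu⟩ := hax
  simp only [World.neg_mem, World.and_mem, not_not] at hu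
  have hlast : ∀ y, Comp x y → B ψ ∉ y → Rel B y u := fun y hy hy' =>
    hB.trans _ _ _ (fun χ hχ => hm₀ χ ⟨y, hy, hy', hχ⟩) hmu
  refine ⟨u, ?_, fun z huz hzu hz => ?_, hlast⟩
  · exact h.comp_trans hy₀ ((hB.comp_iff _ _).2 (Or.inl (hlast y₀ hy₀ fun hc => hψ (hT _ _ hc))))
  · have h1 := (hbox _ _).1 hu.2 z huz
    simp only [World.imp_mem, World.neg_mem, not_not] at h1
    have h2 := (hbox _ _).1 (h1 hz) u hzu
    simp only [World.neg_mem, not_not] at h2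
    exact hu.1 h2

end

/-! ### Completeness for chains -/

/-- The relation of lying in the same cluster. -/
def IsS43.clusterSetoid {L : Set Formula} (h : IsS43 L) : Setoid (World L) where
  r x y := x.R y ∧ y.R x
  iseqv := ⟨fun x => ⟨h.refl x, h.refl x⟩, fun h => ⟨h.2, h.1⟩,
    fun h1 h2 => ⟨h.trans h1.1 h2.1, h.trans h2.2 h1.2⟩⟩

/-- For each subformula keep the last cluster where it fails and the first where it holds; the
Grzegorczyk axioms supply both, uniformly on the cluster. One world from each kept cluster suffices
to witness all modal subformulas, which accounts for the `2 * φ.sub.card` points. -/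
theorem not_valid_chain {L : Set Formula} (h : IsS43 L) (h1 : grz box ∈ L) (h2 : grz bbox ∈ L)
    {φ : Formula} (hφ : φ ∉ L) {n : ℕ} (hn : 2 * φ.sub.card ≤ n + 1) :
    ¬ (FrameType.chain.frame n).Valid φ := by
  classical
  obtain ⟨x, hx⟩ := exists_world_of_notMem h.tense hφ
  have hmax : ∀ ψ, ∃ m, (∃ y, Comp x y ∧ ψ ∉ y) → Comp x m ∧
      (∀ z, m.R z → z.R m → ψ ∉ z) ∧ ∀ y, Comp x y → ψ.box ∉ y → y.R m := by
    intro ψ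
    by_cases hψ : ∃ y, Comp x y ∧ ψ ∉ y
    · obtain ⟨y, hy, hy'⟩ := hψ
      obtain ⟨m, hm⟩ := h.op_box.exists_last h h1 hy hy'
      exact ⟨m, fun _ => hm⟩
    · exact ⟨x, fun hc => absurd hc hψ⟩
  have hmin : ∀ ψ, ∃ m, (∃ y, Comp x y ∧ ψ ∈ y) → Comp x m ∧
      (∀ z : World L, m.R z → z.R m → ψ ∈ z) ∧ ∀ y, Comp x y → ψ.bdia ∈ y → m.R y := by
    intro ψ
    by_cases hψ : ∃ y, Comp x y ∧ ψ ∈ y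
    · obtain ⟨y, hy, hy'⟩ := hψ
      obtain ⟨m, hm1, hm2, hm3⟩ := h.op_bbox.exists_last h h2 hy (ψ := ψ.neg) (by simpa using hy')
      simp only [rel_bbox_iff h.tense, World.neg_mem, not_not, ← bdia_mem_iff h.tense]
        at hm2 hm3
      exact ⟨m, fun _ => ⟨hm1, fun z h1 h2 => hm2 z h2 h1, hm3⟩⟩
    · exact ⟨x, fun hc => absurd hc hψ⟩
  choose mx hmx using hmax
  choose mn hmn using hmin
  -- One fixed representative per cluster, so that distinct selected worlds lie in distinct clusters
  -- and form a chain.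
  let ρ : World L → World L := fun z => (Quotient.mk h.clusterSetoid z).out
  have hρ : ∀ z, (ρ z).R z ∧ z.R (ρ z) := fun z =>
    @Quotient.exact _ h.clusterSetoid _ _ (Quotient.out_eq (Quotient.mk h.clusterSetoid z))
  have hρeq : ∀ y z, (ρ y).R (ρ z) → (ρ z).R (ρ y) → ρ y = ρ z := by
    intro y z h1 h2
    have : Quotient.mk h.clusterSetoid y = Quotient.mk h.clusterSetoid z :=
      Quotient.sound (s := h.clusterSetoid)
        ⟨h.trans (h.trans (hρ y).2 h1) (hρ z).1, h.trans (h.trans (hρ z).2 h2) (hρ y).1⟩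
    simp only [ρ, this]
  let Y : Finset (World L) := (φ.sub.image (ρ ∘ mx) ∪ φ.sub.image (ρ ∘ mn)).filter (Comp x ·)
  have hYρ : ∀ y ∈ Y, ∃ z, y = ρ z := by
    intro y hy
    simp only [Y, Finset.mem_filter, Finset.mem_union, Finset.mem_image, Function.comp] at hy
    rcases hy.1 with ⟨ψ, -, rfl⟩ | ⟨ψ, -, rfl⟩ <;> exact ⟨_, rfl⟩
  have hYcomp : ∀ y ∈ Y, Comp x y := fun y hy => (Finset.mem_filter.1 hy).2
  have hYcard : Y.card ≤ 2 * φ.sub.card := by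
    refine (Finset.card_filter_le _ _).trans ((Finset.card_union_le _ _).trans ?_)
    have := Finset.card_image_le (s := φ.sub) (f := ρ ∘ mx)
    have := Finset.card_image_le (s := φ.sub) (f := ρ ∘ mn)
    omega
  obtain ⟨l, hl1, hl2, hl3⟩ := Finset.exists_sorted_of_total (r := World.R)
    (fun _ _ _ => h.trans) Y fun a ha b hb => h.total (hYcomp a ha) (hYcomp b hb)
  have hmxY : ∀ ψ ∈ φ.sub, ∀ y, Comp x y → ψ ∉ y → ρ (mx ψ) ∈ Y := by
    intro ψ hψ y hy hy'
    refine Finset.mem_filter.2 ⟨Finset.mem_union_left _ (Finset.mem_image_of_mem _ hψ), ?_⟩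
    exact h.comp_rel (hmx ψ ⟨y, hy, hy'⟩).1 (hρ _).2
  have hmnY : ∀ ψ ∈ φ.sub, ∀ y, Comp x y → ψ ∈ y → ρ (mn ψ) ∈ Y := by
    intro ψ hψ y hy hy'
    refine Finset.mem_filter.2 ⟨Finset.mem_union_right _ (Finset.mem_image_of_mem _ hψ), ?_⟩
    exact h.comp_rel (hmn ψ ⟨y, hy, hy'⟩).1 (hρ _).2
  have hφY := hmxY φ φ.self_mem_sub x (h.comp_refl x) hx
  have hpos : 0 < l.length := by
    rw [hl3]
    exact Finset.card_pos.2 ⟨_, hφY⟩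
  -- Indices past the end of `l` repeat its last world, so every sufficiently large `n` is served.
  -- The repetition is harmless: repeated points carry the same world.
  let k : ℕ → ℕ := fun i => min i (l.length - 1)
  have hk : ∀ i, k i < l.length := fun i => by simp only [k]; omega
  let g : Fin (n + 1) → World L := fun i => l[k i]'(hk i)
  have hlmono : ∀ i j (hi : i < l.length) (hj : j < l.length), i ≤ j → (l[i]).R (l[j]) := by
    intro i j hi hj hij
    rcases hij.eq_or_lt with rfl | hij
    · exact h.refl _
    · exact List.pairwise_iff_getElem.1 hl1 i j hi hj hij
  have hgY : ∀ i, g i ∈ Y := fun i => (hl2 _).1 (List.getElem_mem _)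
  have hgj : ∀ y ∈ Y, ∃ j : Fin (n + 1), j.val < l.length ∧ g j = y := by
    intro y hy
    obtain ⟨j, hj, rfl⟩ := List.getElem_of_mem ((hl2 y).2 hy)
    refine ⟨⟨j, by omega⟩, hj, ?_⟩
    have : k j = j := by simp only [k]; omega
    simp only [g, this]
  have hgmono : ∀ a b : Fin (n + 1), a.val ≤ b.val → (g a).R (g b) := fun a b hab =>
    hlmono _ _ _ _ (by simp only [k]; omega)
  have hgrefl : ∀ a b : Fin (n + 1), (g a).R (g b) → ∃ c : Fin (n + 1), a.val ≤ c.val ∧ g c = g b := by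
    intro a b hab
    by_cases hc : a.val ≤ b.val
    · exact ⟨b, hc, rfl⟩
    · refine ⟨a, le_rfl, ?_⟩
      have hba := hgmono b a (by omega)
      obtain ⟨y, hy⟩ := hYρ _ (hgY a)
      obtain ⟨z, hz⟩ := hYρ _ (hgY b)
      rw [hy, hz] at hab hba ⊢
      exact hρeq y z hab hba
  have hgrefl' : ∀ a b : Fin (n + 1), (g b).R (g a) → ∃ c : Fin (n + 1), c.val ≤ a.val ∧ g c = g b := by
    intro a b hab
    by_cases hc : b.val ≤ a.val
    · exact ⟨b, hc, rfl⟩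
    · refine ⟨a, le_rfl, ?_⟩
      have hba := hgmono a b (by omega)
      obtain ⟨y, hy⟩ := hYρ _ (hgY a)
      obtain ⟨z, hz⟩ := hYρ _ (hgY b)
      rw [hy, hz] at hab hba ⊢
      exact hρeq y z hba hab
  have key := sat_iff_mem h.tense (F := FrameType.chain.frame n) g φ.sub hgmono (by
    intro a ψ hψ z haz hz
    have hxz := h.comp_rel (hYcomp _ (hgY a)) haz
    have hm := hmx ψ ⟨z, hxz, hz⟩
    obtain ⟨j, -, hj⟩ := hgj _ (hmxY ψ hψ z hxz hz)
    have haj : (g a).R (g j) := by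
      rw [hj]
      exact h.trans (hm.2.2 _ (hYcomp _ (hgY a)) fun hc => hz (haz _ hc)) (hρ _).2
    obtain ⟨c, hac, hc⟩ := hgrefl a j haj
    refine ⟨c, hac, ?_⟩
    rw [hc, hj]
    exact hm.2.1 _ (hρ _).2 (hρ _).1) (by
    intro a ψ hψ z haz hz
    have hxz := h.comp_rel' (hYcomp _ (hgY a)) haz
    have hm := hmn ψ ⟨z, hxz, hz⟩
    obtain ⟨j, -, hj⟩ := hgj _ (hmnY ψ hψ z hxz hz)
    have haj : (g j).R (g a) := by
      rw [hj]
      exact h.trans (hρ _).1 (hm.2.2 _ (hYcomp _ (hgY a))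
        ((bdia_mem_iff_exists h.tense).2 ⟨z, haz, hz⟩))
    obtain ⟨c, hac, hc⟩ := hgrefl' a j haj
    refine ⟨c, hac, ?_⟩
    rw [hc, hj]
    exact hm.2.1 _ (hρ _).2 (hρ _).1) φ subset_rfl
  intro hv
  obtain ⟨j, -, hj⟩ := hgj _ hφY
  have := (key j).1 (hv _ j)
  rw [hj] at this
  exact (hmx φ ⟨x, h.comp_refl x, hx⟩).2.1 _ (hρ _).2 (hρ _).1 this

/-! ### Completeness for the families of clusters -/

section

variable {L : Set Formula} (h : IsS43 L)
include h

/-- If all pairs of a component are related unless the first is `B`-final or the second is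
`B`-initial, McKinsey's axiom for `B` gives a `B`-final world. -/
theorem IsS43Op.exists_final {B : Formula → Formula} (hB : IsS43Op L B) (hm : mck B ∈ L)
    {x : World L} (hP : ∀ y z, Comp x y → Comp x z → Rel B y z ∨ (∀ u, Rel B y u → u = y) ∨
      ∀ u, Rel B u z → u = z) : ∃ m, Comp x m ∧ ∀ u, Rel B m u → u = m := by
  by_contra hc
  push Not at hc
  have hbox := fun (w : World L) (χ : Formula) =>
    hB.normal.box_mem_iff h.tense (x := w) (ψ := χ)
  have hrel : ∀ y z, Comp x y → Rel B y z → Comp x z := fun y z hy hyz =>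
    h.comp_trans hy ((hB.comp_iff y z).2 (Or.inl hyz))
  -- Without `B`-final worlds, each `y` sees some other `z`, which is then not `B`-initial; by `hP`
  -- the whole component sees `z`.
  have hstep : ∀ y, Comp x y → ∃ z, z ≠ y ∧ Rel B y z ∧ Comp x z ∧ ∀ w, Comp x w → Rel B w z := by
    intro y hy
    obtain ⟨z, hyz, hne⟩ := hc y hy
    refine ⟨z, hne, hyz, hrel y z hy hyz, fun w hw => ?_⟩
    rcases hP w z hw (hrel y z hy hyz) with h1 | h1 | h1
    · exact h1
    · obtain ⟨v, hwv, hne'⟩ := hc w hw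
      exact absurd (h1 v hwv) hne'
    · exact absurd (h1 y hyz).symm hne
  -- Two distinct worlds `u` and `v`, both seen from the whole component. A formula true at `v` and
  -- false at `u` is then never settled, against McKinsey's axiom.
  obtain ⟨u, -, hxu, hu, hu'⟩ := hstep x (h.comp_refl x)
  obtain ⟨v, hvu, huv, hv, hv'⟩ := hstep u hu
  obtain ⟨χ, hχ, hχ'⟩ := World.exists_of_ne hvu
  have hax := World.subst_mem h.tense hm (subst3 χ .bot .bot) u
  simp only [mck, subst_imp, subst_neg, hB.subst, subst_p, subst3_zero, World.imp_mem,
    World.neg_mem] at hax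
  refine hax ((hbox _ _).2 fun z hz => ?_) ((hbox _ _).2 fun z hz => ?_)
  · rw [World.neg_mem]
    exact fun hc => World.neg_mem.1 (hv' z (hrel u z hu hz) _ hc) hχ
  · rw [World.neg_mem]
    exact fun hc => hχ' (hu' z (hrel u z hu hz) _ hc)

/-- If all three alternatives fail, `α` separates `y` from `z`, `β` separates `z` from another
predecessor, and `γ` separates `y` from another successor; the axiom for `α`, `β`, `γ` at `y` is
then violated at `z`. When a flag is off, its formula is a dummy. -/
theorem IsS43.midCluster_canonical {b t : Bool} (hm : midCluster b t ∈ L) {y z : World L}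
    (hyz : Comp y z) : y.R z ∨ (b = true ∧ ∀ u : World L, u.R z → u = z) ∨
      (t = true ∧ ∀ u, y.R u → u = y) := by
  by_contra hc
  simp only [not_or, not_and, not_forall] at hc
  obtain ⟨h1, h2, h3⟩ := hc
  have hzy := hyz.resolve_left h1
  have h1' : ∃ α, α.box ∈ y ∧ α ∉ z := by simpa [Rel] using h1
  obtain ⟨α, hα, hα'⟩ := h1'
  have h2' : ∃ β, b = true → β ∈ z ∧ β.neg.bdia ∈ z := by
    cases b
    · exact ⟨.bot, by simp⟩
    · obtain ⟨u, hu, hne⟩ := h2 rfl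
      obtain ⟨β, hβ, hβ'⟩ := World.exists_of_ne (Ne.symm hne)
      exact ⟨β, fun _ => ⟨hβ, (bdia_mem_iff_exists h.tense).2 ⟨u, hu, by simpa using hβ'⟩⟩⟩
  have h3' : ∃ γ, t = true → γ ∈ y ∧ γ.neg.dia ∈ y := by
    cases t
    · exact ⟨.bot, by simp⟩
    · obtain ⟨u, hu, hne⟩ := h3 rfl
      obtain ⟨γ, hγ, hγ'⟩ := World.exists_of_ne (Ne.symm hne)
      exact ⟨γ, fun _ => ⟨hγ, (dia_mem_iff_exists h.tense).2 ⟨u, hu, by simpa using hγ'⟩⟩⟩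
  obtain ⟨β, hβ⟩ := h2'
  obtain ⟨γ, hγ⟩ := h3'
  have hax := World.subst_mem h.tense hm (subst3 α β γ) y
  have := ((h.tense.normal_bbox.box_mem_iff h.tense).1
    (World.imp_mem.1 hax (World.and_mem.2 ⟨hα, ?_⟩))) z ((rel_bbox_iff h.tense).2 hzy)
  · refine hα' (World.imp_mem.1 this ?_)
    cases b
    · exact World.imp_mem.2 id
    · exact World.and_mem.2 (hβ rfl)
  · cases t
    · exact World.imp_mem.2 id
    · exact World.and_mem.2 (hγ rfl)

/-- The axioms force a component to be one cluster `M` plus at most a least world (if `b`) and a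
greatest world (if `t`). Inside `M` it is enough to keep, for each subformula, one world where it
holds and one where it fails. -/
theorem not_valid_cluster {b t : Bool} (hax : (FrameType.cluster b t).axioms ⊆ L)
    {φ : Formula} (hφ : φ ∉ L) {n : ℕ} (hn : 2 * φ.sub.card + 2 ≤ n) :
    ¬ ((FrameType.cluster b t).frame n).Valid φ := by
  classical
  obtain ⟨x, hx⟩ := exists_world_of_notMem h.tense hφ
  have hP : ∀ y z, Comp x y → Comp x z → y.R z ∨ (b = true ∧ ∀ u : World L, u.R z → u = z) ∨
      (t = true ∧ ∀ u, y.R u → u = y) := fun y z hy hz =>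
    h.midCluster_canonical (hax (Or.inl rfl)) (h.comp_trans hy.symm hz)
  have htop : ∃ m, t = true → Comp x m ∧ ∀ u, m.R u → u = m := by
    cases t
    · exact ⟨x, by simp⟩
    · obtain ⟨m, hm⟩ := h.op_box.exists_final h (hax (by simp [FrameType.axioms])) (x := x)
        fun y z hy hz => (hP y z hy hz).imp_right fun h => h.symm.imp And.right And.right
      exact ⟨m, fun _ => hm⟩
  have hbot : ∃ m, b = true → Comp x m ∧ ∀ u : World L, u.R m → u = m := by
    cases b
    · exact ⟨x, by simp⟩
    · obtain ⟨m, hm⟩ := h.op_bbox.exists_final h (hax (by simp [FrameType.axioms])) (x := x)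
        fun y z hy hz => by
          simp only [rel_bbox_iff h.tense]
          exact (hP z y hz hy).imp_right fun h => h.imp And.right And.right
      simp only [rel_bbox_iff h.tense] at hm
      exact ⟨m, fun _ => hm⟩
  obtain ⟨top, htop⟩ := htop
  obtain ⟨bot, hbot⟩ := hbot
  have hbR : b = true → ∀ z, Comp x z → bot.R z := fun hb z hz => by
    rcases h.total (hbot hb).1 hz with hr | hr
    · exact hr
    · rw [(hbot hb).2 z hr]
      exact h.refl bot
  have htR : t = true → ∀ z, Comp x z → z.R top := fun ht z hz => by
    rcases h.total hz (htop ht).1 with hr | hr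
    · exact hr
    · rw [(htop ht).2 z hr]
      exact h.refl top
  let M : Set (World L) := {z | Comp x z ∧ ¬ (b = true ∧ ∀ u : World L, u.R z → u = z) ∧
    ¬ (t = true ∧ ∀ u, z.R u → u = z)}
  have hMR : ∀ y ∈ M, ∀ z ∈ M, y.R z := fun y hy z hz =>
    ((hP y z hy.1 hz.1).resolve_right fun hc => hc.elim hz.2.1 hy.2.2)
  have hcases : ∀ z, Comp x z → (b = true ∧ z = bot) ∨ (t = true ∧ z = top) ∨ z ∈ M := by
    intro z hz
    by_cases h1 : b = true ∧ ∀ u : World L, u.R z → u = z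
    · exact Or.inl ⟨h1.1, (h1.2 _ (hbR h1.1 z hz)).symm⟩
    by_cases h2 : t = true ∧ ∀ u, z.R u → u = z
    · exact Or.inr (Or.inl ⟨h2.1, (h2.2 _ (htR h2.1 z hz)).symm⟩)
    exact Or.inr (Or.inr ⟨hz, h1, h2⟩)
  -- `S` is to be the image of the cluster of the finite frame. If `M` is empty that cluster still
  -- has points, and they are all sent to `x`.
  obtain ⟨S, s₀, hs₀, hScard, hSM, hSR, hSout, hSin⟩ : ∃ (S : Finset (World L)) (s₀ : World L),
      s₀ ∈ S ∧ S.card ≤ 2 * φ.sub.card + 1 ∧ (∀ s ∈ S, Comp x s) ∧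
      (∀ s ∈ S, ∀ u ∈ S, s.R u) ∧
      (∀ ψ ∈ φ.sub, ∀ z ∈ M, ψ ∉ z → ∃ s ∈ S, s ∈ M ∧ ψ ∉ s) ∧
      (∀ ψ ∈ φ.sub, ∀ z ∈ M, ψ ∈ z → ∃ s ∈ S, s ∈ M ∧ ψ ∈ s) := by
    by_cases hM : M.Nonempty
    · obtain ⟨s₀, hs₀⟩ := hM
      have hout : ∀ ψ : Formula, ∃ s ∈ M, ∀ z ∈ M, ψ ∉ z → ψ ∉ s := by
        intro ψ
        by_cases hc : ∃ z ∈ M, ψ ∉ z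
        · obtain ⟨z, hz, hz'⟩ := hc
          exact ⟨z, hz, fun _ _ _ => hz'⟩
        · exact ⟨s₀, hs₀, fun z hz hz' => absurd ⟨z, hz, hz'⟩ hc⟩
      have hin : ∀ ψ : Formula, ∃ s ∈ M, ∀ z ∈ M, ψ ∈ z → ψ ∈ s := by
        intro ψ
        by_cases hc : ∃ z ∈ M, ψ ∈ z
        · obtain ⟨z, hz, hz'⟩ := hc
          exact ⟨z, hz, fun _ _ _ => hz'⟩
        · exact ⟨s₀, hs₀, fun z hz hz' => absurd ⟨z, hz, hz'⟩ hc⟩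
      choose o ho ho' using hout
      choose i hi hi' using hin
      have hsub : ∀ s ∈ insert s₀ (φ.sub.image o ∪ φ.sub.image i), s ∈ M := by
        intro s hs
        simp only [Finset.mem_insert, Finset.mem_union, Finset.mem_image] at hs
        rcases hs with rfl | ⟨ψ, -, rfl⟩ | ⟨ψ, -, rfl⟩
        · exact hs₀
        · exact ho ψ
        · exact hi ψ
      refine ⟨insert s₀ (φ.sub.image o ∪ φ.sub.image i), s₀, by simp, ?_,
        fun s hs => (hsub s hs).1, fun s hs u hu => hMR s (hsub s hs) u (hsub u hu),
        fun ψ hψ z hz hz' => ⟨o ψ, ?_, ho ψ, ho' ψ z hz hz'⟩,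
        fun ψ hψ z hz hz' => ⟨i ψ, ?_, hi ψ, hi' ψ z hz hz'⟩⟩
      · have h1 := Finset.card_insert_le s₀ (φ.sub.image o ∪ φ.sub.image i)
        have h2 := Finset.card_union_le (φ.sub.image o) (φ.sub.image i)
        have h3 := Finset.card_image_le (s := φ.sub) (f := o)
        have h4 := Finset.card_image_le (s := φ.sub) (f := i)
        omega
      · exact Finset.mem_insert_of_mem (Finset.mem_union_left _ (Finset.mem_image_of_mem _ hψ))
      · exact Finset.mem_insert_of_mem (Finset.mem_union_right _ (Finset.mem_image_of_mem _ hψ))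
    · refine ⟨{x}, x, by simp, by simp, ?_, ?_, fun _ _ z hz => absurd ⟨z, hz⟩ hM,
        fun _ _ z hz => absurd ⟨z, hz⟩ hM⟩
      · simpa using h.comp_refl x
      · simpa using h.refl x
  -- Indices `0` and `1` are reserved for the outer points, so the list of `S` starts at index `2`.
  -- Where no outer point is present, truncated subtraction sends the reserved index to the first
  -- entry; indices past the end give `s₀`.
  let e : ℕ → World L := fun i => S.toList.getD (i - 2) s₀
  have heS : ∀ i, e i ∈ S := by
    intro i
    by_cases hi : i - 2 < S.toList.length
    · simp only [e, List.getD_eq_getElem _ _ hi]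
      exact Finset.mem_toList.1 (List.getElem_mem hi)
    · simp only [e, List.getD_eq_default _ _ (not_lt.1 hi)]
      exact hs₀
  have heSurj : ∀ s ∈ S, ∃ i : Fin (n + 1), 2 ≤ i.val ∧ e i = s := by
    intro s hs
    obtain ⟨j, hj, rfl⟩ := List.getElem_of_mem (Finset.mem_toList.2 hs)
    have hj' := hj
    rw [Finset.length_toList] at hj'
    refine ⟨⟨j + 2, by omega⟩, by simp, ?_⟩
    simp only [e, Nat.add_sub_cancel, List.getD_eq_getElem _ _ hj]
  let g : ℕ → World L := fun i =>
    if b = true ∧ i = 0 then bot else if t = true ∧ i = 1 then top else e i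
  have hgb : b = true → g 0 = bot := fun hb => if_pos ⟨hb, rfl⟩
  have hgt : t = true → g 1 = top := fun ht =>
    (if_neg fun hc => one_ne_zero hc.2).trans (if_pos ⟨ht, rfl⟩)
  have hge : ∀ i, ¬ (b = true ∧ i = 0) → ¬ (t = true ∧ i = 1) → g i = e i := fun i h1 h2 =>
    (if_neg h1).trans (if_neg h2)
  have hgC : ∀ i, Comp x (g i) := by
    intro i
    by_cases h1 : b = true ∧ i = 0
    · rw [h1.2, hgb h1.1]
      exact (hbot h1.1).1
    by_cases h2 : t = true ∧ i = 1
    · rw [h2.2, hgt h2.1]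
      exact (htop h2.1).1
    · rw [hge i h1 h2]
      exact hSM _ (heS i)
  have hrefl : ∀ i, (FrameType.cluster b t).rel i i := fun i => ⟨fun _ => id, fun _ => id⟩
  have hmono : ∀ i j, (FrameType.cluster b t).rel i j → (g i).R (g j) := by
    intro i j hij
    by_cases h1 : b = true ∧ i = 0
    · rw [h1.2, hgb h1.1]
      exact hbR h1.1 _ (hgC j)
    by_cases h2 : t = true ∧ j = 1
    · rw [h2.2, hgt h2.1]
      exact htR h2.1 _ (hgC i)
    have h3 : ¬ (t = true ∧ i = 1) := fun hc => h2 ⟨hc.1, hij.2 hc.1 hc.2⟩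
    have h4 : ¬ (b = true ∧ j = 0) := fun hc => h1 ⟨hc.1, hij.1 hc.1 hc.2⟩
    rw [hge i h1 h3, hge j h4 h2]
    exact hSR _ (heS i) _ (heS j)
  have key := sat_iff_mem h.tense (F := (FrameType.cluster b t).frame n)
    (fun i : Fin (n + 1) => g i) φ.sub (fun i j hij => hmono _ _ hij) (by
    intro a ψ hψ z haz hz
    rcases hcases z (h.comp_rel (hgC _) haz) with ⟨hb, rfl⟩ | ⟨ht, rfl⟩ | hzM
    · refine ⟨a, hrefl _, ?_⟩
      rwa [(hbot hb).2 _ haz]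
    · refine ⟨(⟨1, by omega⟩ : Fin (n + 1)), ⟨fun _ hc => absurd hc one_ne_zero, fun _ _ => rfl⟩, ?_⟩
      change ψ ∉ g 1
      rwa [hgt ht]
    · obtain ⟨s, hs, hsM, hsψ⟩ := hSout ψ hψ z hzM hz
      obtain ⟨j, hj, rfl⟩ := heSurj s hs
      refine ⟨j, ⟨fun _ hc => by omega, fun ht ha => ?_⟩, ?_⟩
      · rw [ha, hgt ht] at haz
        refine absurd ⟨ht, ?_⟩ hzM.2.2
        rw [(htop ht).2 z haz]
        exact (htop ht).2
      · by_cases h2 : t = true ∧ j.val = 1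
        · omega
        · rwa [hge j (fun hc => by omega) h2]) (by
    intro a ψ hψ z haz hz
    rcases hcases z (h.comp_rel' (hgC _) haz) with ⟨hb, rfl⟩ | ⟨ht, rfl⟩ | hzM
    · refine ⟨(0 : Fin (n + 1)), (FrameType.cluster b t).rel_zero _, ?_⟩
      change ψ ∈ g 0
      rwa [hgb hb]
    · refine ⟨a, hrefl _, ?_⟩
      rwa [(htop ht).2 _ haz]
    · obtain ⟨s, hs, hsM, hsψ⟩ := hSin ψ hψ z hzM hz
      obtain ⟨j, hj, rfl⟩ := heSurj s hs
      refine ⟨j, ⟨fun hb ha => ?_, fun _ hc => by omega⟩, ?_⟩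
      · rw [ha, hgb hb] at haz
        refine absurd ⟨hb, ?_⟩ hzM.2.1
        rw [(hbot hb).2 z haz]
        exact (hbot hb).2
      · rwa [hge j (fun hc => by omega) (fun hc => by omega)]) φ subset_rfl
  intro hv
  have hall : ∀ i : Fin (n + 1), φ ∈ g i := fun i => (key i).1 (hv _ i)
  rcases hcases x (h.comp_refl x) with ⟨hb, hxb⟩ | ⟨ht, hxt⟩ | hxM
  · refine hx ?_
    rw [hxb, ← hgb hb]
    exact hall 0
  · refine hx ?_
    rw [hxt, ← hgt ht]
    exact hall ⟨1, by omega⟩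
  · obtain ⟨s, hs, -, hsφ⟩ := hSout φ φ.self_mem_sub x hxM hx
    obtain ⟨j, hj, rfl⟩ := heSurj s hs
    have := hall j
    rw [hge j (fun hc => by omega) (fun hc => by omega)] at this
    exact hsφ this

end

/-- A number of points on which every non-theorem of a family is refuted. -/
def FrameType.bound (φ : Formula) : ℕ := 2 * φ.code + 4

theorem not_valid_of_notMem {L : Set Formula} (h : IsS43 L) {τ : FrameType} (hax : τ.axioms ⊆ L)
    {φ : Formula} (hφ : φ ∉ L) {n : ℕ} (hn : FrameType.bound φ ≤ n) : ¬ (τ.frame n).Valid φ := by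
  -- Gives `2 * φ.sub.card + 2 ≤ 2 * φ.code + 4`, enough for both kinds of family.
  have hc := φ.card_sub_le
  simp only [FrameType.bound] at hn
  cases τ with
  | chain =>
    exact not_valid_chain h (hax (Or.inl rfl)) (hax (Or.inr rfl)) hφ (by omega)
  | cluster b t => exact not_valid_cluster h hax hφ (by omega)

/-! ### Unbounded components -/

section

variable {L : Set Formula}

/-- The strict part of the relation of the canonical frame. -/
def World.Lt (x y : World L) : Prop := x.R y ∧ ¬ y.R x

variable (h : IsS43 L)
include h

theorem IsS43.lt_trans {x y z : World L} (hxy : x.Lt y) (hyz : y.Lt z) : x.Lt z :=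
  ⟨h.trans hxy.1 hyz.1, fun hc => hxy.2 (h.trans hyz.1 hc)⟩

/-- Strictness gives formulas `□δ` that hold at one world of the list and fail at its predecessor.
They persist upwards, so the greatest index whose formula holds is a monotone map onto the chain
with definable fibres, and totality of the component makes it a bounded morphism. -/
theorem valid_chain_of_lt {n : ℕ} {l : List (World L)} (hl : l.Pairwise World.Lt)
    (hn : l.length = n + 1) {φ : Formula} (hφ : φ ∈ L) : (FrameType.chain.frame n).Valid φ := by
  classical
  have hδ : ∀ i, ∃ δ, ∀ hi : i + 1 < l.length, box δ ∈ l[i + 1] ∧ δ ∉ l[i] := by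
    intro i
    by_cases hi : i + 1 < l.length
    · have h1 := (List.pairwise_iff_getElem.1 hl i (i + 1) (by omega) hi (by omega)).2
      simp only [World.R, Rel, not_forall] at h1
      obtain ⟨δ, h1, h2⟩ := h1
      exact ⟨δ, fun _ => ⟨h1, h2⟩⟩
    · exact ⟨.bot, fun hc => absurd hc hi⟩
  choose δ hδ using hδ
  -- `θ 0` is a theorem, so a greatest index always exists. The `θ i` need not be nested, hence the
  -- fibre of `a` is cut out by `θ a` together with the negations of all later ones.
  let θ : ℕ → Formula
    | 0 => box (imp bot bot)
    | i + 1 => box (δ i)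
  have hθR : ∀ i (y z : World L), y.R z → θ i ∈ y → θ i ∈ z := by
    intro i y z hyz hy
    cases i with
    | zero => exact World.of_logic (h.tense.normal_box.nec _ (h.tense.imp_self _))
    | succ i =>
      exact (h.tense.normal_box.box_mem_iff h.tense).2 fun u hu => h.trans hyz hu _ hy
  have hθ0 : ∀ y : World L, θ 0 ∈ y := fun y =>
    World.of_logic (h.tense.normal_box.nec _ (h.tense.imp_self _))
  have hlR : ∀ i j (hi : i < l.length) (hj : j < l.length), i ≤ j → (l[i]).R (l[j]) := by
    intro i j hi hj hij
    rcases hij.eq_or_lt with rfl | hij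
    · exact h.refl _
    · exact (List.pairwise_iff_getElem.1 hl i j hi hj hij).1
  have hθl : ∀ i (hi : i < l.length), θ i ∈ l[i] := by
    intro i hi
    cases i with
    | zero => exact hθ0 _
    | succ i => exact (hδ i hi).1
  have hθl' : ∀ i j (hi : i < l.length) (hj : j < l.length), i < j → θ j ∉ l[i] := by
    intro i j hi hj hij hc
    cases j with
    | zero => omega
    | succ j =>
      exact (hδ j hj).2 (h.refl _ _ (hθR (j + 1) _ _ (hlR i j hi (by omega) (by omega)) hc))
  let x := l[0]'(by omega)
  have hlx : ∀ i (hi : i < l.length), Comp x (l[i]) := fun i hi =>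
    Or.inl (hlR 0 i (by omega) hi (by omega))
  let f : World L → Fin (n + 1) := fun y =>
    ⟨Nat.findGreatest (θ · ∈ y) n, Nat.lt_succ_of_le (Nat.findGreatest_le n)⟩
  have hfθ : ∀ y, θ (f y) ∈ y := fun y =>
    Nat.findGreatest_spec (P := (θ · ∈ y)) (Nat.zero_le n) (hθ0 y)
  have hle : ∀ y (a : Fin (n + 1)), θ a ∈ y → a ≤ f y := fun y a ha =>
    Nat.le_findGreatest (P := (θ · ∈ y)) (Nat.le_of_lt_succ a.2) ha
  have hmono : ∀ y z, y.R z → f y ≤ f z := fun y z hyz => hle z _ (hθR _ y z hyz (hfθ y))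
  have hfl : ∀ a : Fin (n + 1), f (l[a.val]'(by omega)) = a := by
    intro a
    refine le_antisymm ?_ (hle _ _ (hθl a (by omega)))
    by_contra hc
    exact hθl' a (f (l[a.val]'(by omega))) (by omega) (by omega) (not_le.1 hc) (hfθ _)
  refine valid_of_definable_morphism h (F := FrameType.chain.frame n) (x := x) f ?_
    (fun y z _ hyz => hmono y z hyz) ?_ ?_ (fun a => ⟨_, hlx a.val (by omega), hfl a⟩) hφ
  · intro (a : Fin (n + 1))
    refine ((DefIn.mem (θ a)).inter (DefIn.biInter (Finset.Ioc a.val n)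
      (U := fun j => {y | θ j ∈ y}ᶜ) fun j _ => (DefIn.mem (θ j)).compl)).congr fun y _ => ?_
    constructor
    · rintro ⟨h1, h2⟩
      refine le_antisymm (α := Fin (n + 1)) ?_ (hle y a h1)
      by_contra hc
      exact h2 (f y).val (Finset.mem_Ioc.2 ⟨not_le.1 hc, Nat.le_of_lt_succ (f y).2⟩) (hfθ y)
    · rintro rfl
      refine ⟨hfθ y, fun j hj hc => ?_⟩
      rw [Finset.mem_Ioc] at hj
      exact absurd (hle y ⟨j, by omega⟩ hc) (not_le.2 hj.1)
  · intro y (a : Fin (n + 1)) hy (hya : f y ≤ a)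
    rcases h.total hy (hlx a.val (by omega)) with hr | hr
    · exact ⟨_, hr, hfl a⟩
    · refine ⟨y, h.refl y, le_antisymm (α := Fin (n + 1)) hya ?_⟩
      rw [← hfl a]
      exact hmono _ _ hr
  · intro y (a : Fin (n + 1)) hy (hya : a ≤ f y)
    rcases h.total hy (hlx a.val (by omega)) with hr | hr
    · refine ⟨y, h.refl y, le_antisymm (α := Fin (n + 1)) ?_ hya⟩
      conv_rhs => rw [← hfl a]
      exact hmono _ _ hr
    · exact ⟨_, hr, hfl a⟩

/-- Collapse the worlds strictly below the cluster of `y` to `0`, those strictly above to `1`, and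
retract the cluster onto finitely many of its worlds. Definability of the up-set and down-set of `y`
makes the three regions, and so all fibres, definable. -/
theorem valid_cluster_of_card {b t : Bool} {n : ℕ} (hn : 2 ≤ n) {y : World L}
    (hb : b = true ↔ ∃ z, World.Lt z y) (ht : t = true ↔ ∃ z, World.Lt y z)
    (hup : DefIn y {z | y.R z}) (hdn : DefIn y {z | World.R z y}) {c : Fin (n + 1) → World L}
    (hc : Function.Injective c) (hcy : ∀ i, (c i).R y ∧ y.R (c i)) {φ : Formula} (hφ : φ ∈ L) :
    ((FrameType.cluster b t).frame n).Valid φ := by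
  classical
  -- The indices left for the cluster once the outer points have taken theirs; `2 ≤ n` keeps it
  -- nonempty.
  let J : Finset (Fin (n + 1)) :=
    Finset.univ.filter fun j => ¬ (b = true ∧ j.val = 0) ∧ ¬ (t = true ∧ j.val = 1)
  have hJ : ∀ j, j ∈ J ↔ ¬ (b = true ∧ j.val = 0) ∧ ¬ (t = true ∧ j.val = 1) := by simp [J]
  have hJne : (J.image c).Nonempty :=
    Finset.Nonempty.image ⟨⟨2, by omega⟩, (hJ _).2 (by simp)⟩ c
  obtain ⟨g, hg1, hg2, hg3⟩ := DefIn.exists_retract y (J.image c) hJne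
  let k : World L → Fin (n + 1) := fun z => Function.invFun c (g z)
  have hkJ : ∀ z, k z ∈ J := by
    intro z
    obtain ⟨j, hj, hj'⟩ := Finset.mem_image.1 (hg2 z)
    have : k z = j := by
      simp only [k, ← hj']
      exact Function.leftInverse_invFun hc j
    rwa [this]
  have hkc : ∀ j ∈ J, k (c j) = j := by
    intro j hj
    simp only [k, hg1 _ (Finset.mem_image_of_mem c hj)]
    exact Function.leftInverse_invFun hc j
  let U : Set (World L) := {z | y.R z}
  let D : Set (World L) := {z | World.R z y}
  let f : World L → Fin (n + 1) := fun z =>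
    if z ∈ Uᶜ then ⟨0, by omega⟩ else if z ∈ Dᶜ then ⟨1, by omega⟩ else k z
  have hf0 : ∀ z, ¬ y.R z → f z = ⟨0, by omega⟩ := fun z hz => if_pos hz
  have hf1 : ∀ z, World.Lt y z → f z = ⟨1, by omega⟩ := fun z hz =>
    (if_neg fun hc => hc hz.1).trans (if_pos hz.2)
  have hfk : ∀ z, y.R z → z.R y → f z = k z := fun z h1 h2 =>
    (if_neg fun hc => hc h1).trans (if_neg fun hc => hc h2)
  have hlt : ∀ z, Comp y z → ¬ y.R z → World.Lt z y := fun z hz hn => ⟨hz.resolve_left hn, hn⟩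
  have hcases : ∀ z, Comp y z → (World.Lt z y ∧ b = true ∧ (f z).val = 0) ∨
      (World.Lt y z ∧ t = true ∧ (f z).val = 1) ∨ (y.R z ∧ z.R y ∧ f z = k z) := by
    intro z hz
    by_cases h1 : y.R z
    · by_cases h2 : z.R y
      · exact Or.inr (Or.inr ⟨h1, h2, hfk z h1 h2⟩)
      · exact Or.inr (Or.inl ⟨⟨h1, h2⟩, ht.2 ⟨z, h1, h2⟩, by rw [hf1 z ⟨h1, h2⟩]⟩)
    · exact Or.inl ⟨hlt z hz h1, hb.2 ⟨z, hlt z hz h1⟩, by rw [hf0 z h1]⟩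
  have hbot : ∀ z, Comp y z → b = true → (f z).val = 0 → World.Lt z y := by
    intro z hz hb hz0
    rcases hcases z hz with h1 | h1 | h1
    · exact h1.1
    · omega
    · rw [h1.2.2] at hz0
      exact absurd ⟨hb, hz0⟩ ((hJ _).1 (hkJ z)).1
  have htop : ∀ z, Comp y z → t = true → (f z).val = 1 → World.Lt y z := by
    intro z hz ht hz1
    rcases hcases z hz with h1 | h1 | h1
    · omega
    · exact h1.1
    · rw [h1.2.2] at hz1
      exact absurd ⟨ht, hz1⟩ ((hJ _).1 (hkJ z)).2
  have hpt : ∀ a : Fin (n + 1), (∃ z, World.Lt z y ∧ b = true ∧ a.val = 0 ∧ f z = a) ∨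
      (∃ z, World.Lt y z ∧ t = true ∧ a.val = 1 ∧ f z = a) ∨
      (a ∈ J ∧ ∃ z, y.R z ∧ z.R y ∧ f z = a) := by
    intro a
    by_cases h0 : b = true ∧ a.val = 0
    · obtain ⟨z, hz⟩ := hb.1 h0.1
      exact Or.inl ⟨z, hz, h0.1, h0.2, by rw [hf0 z hz.2]; exact Fin.ext h0.2.symm⟩
    by_cases h1 : t = true ∧ a.val = 1
    · obtain ⟨z, hz⟩ := ht.1 h1.1
      exact Or.inr (Or.inl ⟨z, hz, h1.1, h1.2, by rw [hf1 z hz]; exact Fin.ext h1.2.symm⟩)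
    have haJ := (hJ a).2 ⟨h0, h1⟩
    exact Or.inr (Or.inr ⟨haJ, c a, (hcy a).2, (hcy a).1,
      by rw [hfk _ (hcy a).2 (hcy a).1, hkc a haJ]⟩)
  refine valid_of_definable_morphism h (F := (FrameType.cluster b t).frame n) (x := y) f ?_
    ?_ ?_ ?_ ?_ hφ
  · intro (a : Fin (n + 1))
    refine hup.compl.ite (DefIn.const _) (hdn.compl.ite (DefIn.const _) ?_)
    refine (DefIn.biUnion ((J.image c).filter fun w => Function.invFun c w = a)
      (fun w _ => hg3 w)).congr fun z _ => ?_
    simp only [Finset.mem_filter, Set.mem_ofPred_eq, k]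
    constructor
    · rintro ⟨w, ⟨-, hw⟩, rfl⟩
      exact hw
    · exact fun hz => ⟨g z, ⟨hg2 z, hz⟩, rfl⟩
  · intro z u hz hzu
    refine ⟨fun hb' hu0 => ?_, fun ht' hz1 => ?_⟩
    · have := hbot u (h.comp_rel hz hzu) hb' hu0
      rw [hf0 z fun hc => this.2 (h.trans hc hzu)]
    · have := htop z hz ht' hz1
      rw [hf1 u ⟨h.trans this.1 hzu, fun hc => this.2 (h.trans hzu hc)⟩]
  · intro z (a : Fin (n + 1)) hz hza
    rcases hpt a with ⟨u, hu, hb', ha, hua⟩ | ⟨u, hu, ht', ha, hua⟩ | ⟨haJ, u, hu1, hu2, hua⟩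
    · refine ⟨z, h.refl z, ?_⟩
      rw [hf0 z (hbot z hz hb' (hza.1 hb' ha)).2]
      exact Fin.ext ha.symm
    · by_cases hc : z.R y
      · exact ⟨u, h.trans hc hu.1, hua⟩
      · refine ⟨z, h.refl z, ?_⟩
        rw [hf1 z ⟨hz.resolve_right hc, hc⟩]
        exact Fin.ext ha.symm
    · refine ⟨u, ?_, hua⟩
      by_cases hc : z.R y
      · exact h.trans hc hu1
      · have hlt : World.Lt y z := ⟨hz.resolve_right hc, hc⟩
        have ht' := ht.2 ⟨z, hlt⟩
        exact absurd ⟨ht', hza.2 ht' (by rw [hf1 z hlt])⟩ ((hJ a).1 haJ).2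
  · intro z (a : Fin (n + 1)) hz hza
    rcases hpt a with ⟨u, hu, hb', ha, hua⟩ | ⟨u, hu, ht', ha, hua⟩ | ⟨haJ, u, hu1, hu2, hua⟩
    · by_cases hc : y.R z
      · exact ⟨u, h.trans hu.1 hc, hua⟩
      · refine ⟨z, h.refl z, ?_⟩
        rw [hf0 z hc]
        exact Fin.ext ha.symm
    · refine ⟨z, h.refl z, ?_⟩
      rw [hf1 z (htop z hz ht' (hza.2 ht' ha))]
      exact Fin.ext ha.symm
    · refine ⟨u, ?_, hua⟩
      by_cases hc : y.R z
      · exact h.trans hu2 hc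
      · have hlt := hlt z hz hc
        have hb' := hb.2 ⟨z, hlt⟩
        exact absurd ⟨hb', hza.1 hb' (by rw [hf0 z hc])⟩ ((hJ a).1 haJ).1
  · intro (a : Fin (n + 1))
    rcases hpt a with ⟨u, hu, -, -, hua⟩ | ⟨u, hu, -, -, hua⟩ | ⟨-, u, hu1, hu2, hua⟩
    · exact ⟨u, Or.inr hu.1, hua⟩
    · exact ⟨u, Or.inl hu.1, hua⟩
    · exact ⟨u, Or.inl hu1, hua⟩

/-! ### Bounded components -/

theorem IsS43.wellFounded_lt {n : ℕ}
    (hn : ∀ l : List (World L), l.Pairwise World.Lt → l.length ≠ n) :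
    WellFounded (World.Lt (L := L)) := by
  rw [wellFounded_iff_isEmpty_descending_chain]
  refine ⟨fun ⟨f, hf⟩ => hn ((List.range n).map f).reverse ?_ (by simp)⟩
  have : IsTrans (World L) fun x y => World.Lt y x := ⟨fun _ _ _ h1 h2 => h.lt_trans h2 h1⟩
  rw [List.pairwise_reverse, List.pairwise_map]
  exact List.pairwise_lt_range.imp fun hij =>
    Nat.rel_of_forall_rel_succ_of_lt (fun x y => World.Lt y x) hf hij

theorem IsS43.wellFounded_gt {n : ℕ}
    (hn : ∀ l : List (World L), l.Pairwise World.Lt → l.length ≠ n) :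
    WellFounded fun x y : World L => World.Lt y x := by
  rw [wellFounded_iff_isEmpty_descending_chain]
  refine ⟨fun ⟨f, hf⟩ => hn ((List.range n).map f) ?_ (by simp)⟩
  have : IsTrans (World L) World.Lt := ⟨fun _ _ _ h1 h2 => h.lt_trans h1 h2⟩
  rw [List.pairwise_map]
  exact List.pairwise_lt_range.imp fun hij => Nat.rel_of_forall_rel_succ_of_lt World.Lt hf hij

/-- Bounded chains yield a maximal `u` strictly below `y`. If `□δ ∈ y` and `δ ∉ u`, then `□δ` holds
exactly from `y` on, since every world strictly below `y` sees `u`. -/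
theorem IsS43.defIn_up {n : ℕ} (hn : ∀ l : List (World L), l.Pairwise World.Lt → l.length ≠ n)
    {x y : World L} (hxy : Comp x y) : DefIn x {z | y.R z} := by
  by_cases hne : {u | World.Lt u y}.Nonempty
  · obtain ⟨u, hu, hmax⟩ := (h.wellFounded_gt hn).has_min _ hne
    have h1 := hu.2
    simp only [World.R, Rel, not_forall] at h1
    obtain ⟨δ, h1, h2⟩ := h1
    refine (DefIn.mem δ.box).congr fun z hz => ⟨fun hδ => ?_, fun hyz => ?_⟩
    · by_contra hc
      have hzy : World.Lt z y := ⟨(h.total hxy hz).resolve_left hc, hc⟩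
      have hzu : z.R u := by
        by_contra hzu
        exact hmax z hzy ⟨(h.total (h.comp_rel' hxy hu.1) hz).resolve_right hzu, hzu⟩
      exact h2 (hzu _ hδ)
    · exact (h.tense.normal_box.box_mem_iff h.tense).2 fun v hv => h.trans hyz hv _ h1
  · refine (DefIn.const True).congr fun z hz => ⟨fun _ => ?_, fun _ => trivial⟩
    by_contra hc
    exact hne ⟨z, (h.total hxy hz).resolve_left hc, hc⟩

/-- The down-set of `y` is the complement of the up-set of a minimal world strictly above `y`. -/
theorem IsS43.defIn_down {n : ℕ} (hn : ∀ l : List (World L), l.Pairwise World.Lt → l.length ≠ n)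
    {x y : World L} (hxy : Comp x y) : DefIn x {z | World.R z y} := by
  by_cases hne : {u | World.Lt y u}.Nonempty
  · obtain ⟨u, hu, hmin⟩ := (h.wellFounded_lt hn).has_min _ hne
    refine (h.defIn_up hn (h.comp_rel hxy hu.1)).compl.congr fun z hz => ⟨fun huz => ?_, fun hzy huz => ?_⟩
    · by_contra hc
      have hyz : World.Lt y z := ⟨(h.total hxy hz).resolve_right hc, hc⟩
      exact hmin z hyz ⟨(h.total (h.comp_rel hxy hu.1) hz).resolve_left huz, huz⟩
    · exact hu.2 (h.trans huz hzy)
  · refine (DefIn.const True).congr fun z hz => ⟨fun _ => ?_, fun _ => trivial⟩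
    by_contra hc
    exact hne ⟨z, (h.total hxy hz).resolve_right hc, hc⟩

/-- Removing the least cluster from `T` costs at most `M` worlds and contributes one point to the
strict chain. -/
theorem IsS43.exists_lt_chain {M : ℕ} (n : ℕ) (T : Finset (World L))
    (htot : ∀ a ∈ T, ∀ b ∈ T, a.R b ∨ b.R a)
    (hM : ∀ y, ∀ C ⊆ T, (∀ c ∈ C, c.R y ∧ y.R c) → C.card ≤ M) (hT : n * M < T.card) :
    ∃ l : List (World L), l.Pairwise World.Lt ∧ l.length = n + 1 ∧ ∀ a ∈ l, a ∈ T := by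
  classical
  induction n generalizing T with
  | zero =>
    obtain ⟨a, ha⟩ := Finset.card_pos.1 (by omega : 0 < T.card)
    exact ⟨[a], by simp, by simp, by simpa using ha⟩
  | succ n ih =>
    obtain ⟨m, hm, hmin⟩ := Finset.exists_least_of_total (r := World.R) (fun _ _ _ => h.trans) T
      (Finset.card_pos.1 (by omega)) htot
    have hC := hM m (T.filter fun a => a.R m ∧ m.R a) (Finset.filter_subset _ _)
      fun c hc => (Finset.mem_filter.1 hc).2
    have hsplit := Finset.card_filter_add_card_filter_not (s := T) (fun a => a.R m ∧ m.R a)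
    obtain ⟨l, hl1, hl2, hl3⟩ := ih (T.filter fun a => ¬ (a.R m ∧ m.R a))
      (fun a ha b hb => htot a (Finset.mem_filter.1 ha).1 b (Finset.mem_filter.1 hb).1)
      (fun y C hC => hM y C (hC.trans (Finset.filter_subset _ _)))
      (by rw [Nat.succ_mul] at hT; omega)
    refine ⟨m :: l, List.pairwise_cons.2 ⟨fun a ha => ?_, hl1⟩, by simp [hl2], fun a ha => ?_⟩
    · have := Finset.mem_filter.1 (hl3 a ha)
      exact ⟨hmin a this.1, fun hc => this.2 ⟨hc, hmin a this.1⟩⟩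
    · rcases List.mem_cons.1 ha with rfl | ha
      · exact hm
      · exact (Finset.mem_filter.1 (hl3 a ha)).1

end

/-! ### Tabularity from bounded components, and the dichotomy -/

/-- The disjoint union of a family of frames. -/
def KFrame.sigma {ι : Type} [hι : Nonempty ι] (F : ι → KFrame) : KFrame where
  X := Σ i, (F i).X
  nonempty := hι.elim fun i => (F i).nonempty.elim fun x => ⟨⟨i, x⟩⟩
  R a b := ∃ i x y, a = ⟨i, x⟩ ∧ b = ⟨i, y⟩ ∧ (F i).R x y

section

variable {ι : Type} [hι : Nonempty ι] {F : ι → KFrame}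

theorem KFrame.sigma_R {i : ι} {x : (F i).X} {b : Σ i, (F i).X} :
    (KFrame.sigma F).R ⟨i, x⟩ b ↔ ∃ y, b = ⟨i, y⟩ ∧ (F i).R x y := by
  constructor
  · rintro ⟨j, x', y, h1, h2, h3⟩
    cases h1
    exact ⟨y, h2, h3⟩
  · rintro ⟨y, h1, h2⟩
    exact ⟨i, x, y, rfl, h1, h2⟩

theorem KFrame.sigma_R' {i : ι} {x : (F i).X} {b : Σ i, (F i).X} :
    (KFrame.sigma F).R b ⟨i, x⟩ ↔ ∃ y, b = ⟨i, y⟩ ∧ (F i).R y x := by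
  constructor
  · rintro ⟨j, y, x', h1, h2, h3⟩
    cases h2
    exact ⟨y, h1, h3⟩
  · rintro ⟨y, h1, h2⟩
    exact ⟨i, y, x, h1, rfl, h2⟩

theorem KFrame.sat_sigma {V : ℕ → Set (Σ i, (F i).X)} {i : ι} {x : (F i).X} {φ : Formula} :
    (KFrame.sigma F).Sat V ⟨i, x⟩ φ ↔ (F i).Sat (fun k => {y | ⟨i, y⟩ ∈ V k}) x φ := by
  induction φ generalizing x with
  | p k => rfl
  | bot => rfl
  | imp φ ψ h1 h2 => exact imp_congr h1 h2
  | box φ ih =>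
    constructor
    · exact fun h y hy => ih.1 (h _ (sigma_R.2 ⟨y, rfl, hy⟩))
    · intro h b hb
      obtain ⟨y, rfl, hy⟩ := sigma_R.1 hb
      exact ih.2 (h y hy)
  | bdia φ ih =>
    constructor
    · rintro ⟨b, hb, h⟩
      obtain ⟨y, rfl, hy⟩ := sigma_R'.1 hb
      exact ⟨y, hy, ih.1 h⟩
    · rintro ⟨y, hy, h⟩
      exact ⟨⟨i, y⟩, sigma_R'.2 ⟨y, rfl, hy⟩, ih.2 h⟩

theorem KFrame.valid_sigma {φ : Formula} : (KFrame.sigma F).Valid φ ↔ ∀ i, (F i).Valid φ := by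
  classical
  constructor
  · intro h i V x
    have := sat_sigma.1 (h (fun k => {a | ∃ y ∈ V k, a = ⟨i, y⟩}) ⟨i, x⟩)
    have hV : (fun k => {y | (⟨i, y⟩ : Σ i, (F i).X) ∈
        {a : Σ i, (F i).X | ∃ y ∈ V k, a = ⟨i, y⟩}}) = V := by
      funext k
      ext y
      constructor
      · rintro ⟨z, hz, hyz⟩
        cases hyz
        exact hz
      · exact fun hy => ⟨y, hy, rfl⟩
    exact hV ▸ this
  · rintro h V ⟨i, x⟩
    exact sat_sigma.2 (h i _ x)

end

/-- If the components of the canonical frame have bounded finite size, the logic is tabular. -/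
theorem isTabular_of_card_le {L : Set Formula} (h : IsS43 L) (hcons : IsConsistent L) {K : ℕ}
    (hK : ∀ (x : World L) (T : Finset (World L)), (∀ y ∈ T, Comp x y) → T.card ≤ K) :
    IsTabular L := by
  classical
  let G : (k : ℕ) → (Fin (k + 1) → Fin (k + 1) → Prop) → KFrame := fun k r => ⟨Fin (k + 1), ⟨0⟩, r⟩
  -- There may be infinitely many components, but only finitely many relations on at most `K + 1`
  -- points. The disjoint union ranges over all such frames validating `L`, and each component is
  -- isomorphic to one of them.
  let ι : Type := Σ k : Fin (K + 1), {r : Fin (k + 1) → Fin (k + 1) → Prop // ∀ φ ∈ L, (G k r).Valid φ}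
  have hcomp : ∀ x : World L, ∃ (i : ι) (g : Fin (i.1 + 1) → World L),
      (∀ a b, i.2.1 a b ↔ (g a).R (g b)) ∧ ∀ y, Comp x y ↔ ∃ a, g a = y := by
    intro x
    have hfin : {y | Comp x y}.Finite := by
      by_contra hinf
      obtain ⟨T, hT, hcard⟩ := Set.Infinite.exists_subset_card_eq hinf (K + 1)
      have := hK x T fun y hy => hT hy
      omega
    set T := hfin.toFinset
    have hT : ∀ y, y ∈ T ↔ Comp x y := fun y => by simp [T]
    have hxT : x ∈ T := (hT x).2 (h.comp_refl x)
    have hcard := hK x T fun y hy => (hT y).1 hy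
    obtain ⟨k, hk⟩ : ∃ k, T.card = k + 1 := ⟨T.card - 1, by
      have := Finset.card_pos.2 ⟨x, hxT⟩
      omega⟩
    let e : T ≃ Fin (k + 1) := T.equivFinOfCardEq hk
    let g : Fin (k + 1) → World L := fun a => (e.symm a).1
    have hg : ∀ a, Comp x (g a) := fun a => (hT _).1 (e.symm a).2
    let f : World L → Fin (k + 1) := fun y => if hy : y ∈ T then e ⟨y, hy⟩ else 0
    have hfg : ∀ a, f (g a) = a := fun a => by
      simp only [f, g, Subtype.coe_eta, Equiv.apply_symm_apply, (e.symm a).2, dite_true]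
    have hgf : ∀ y, Comp x y → g (f y) = y := fun y hy => by
      simp only [f, g, (hT y).2 hy, dite_true, Equiv.symm_apply_apply]
    -- Retracting onto the whole component shows that each of its worlds is definable there, so the
    -- isomorphism `f` has definable fibres.
    obtain ⟨ρ, hρ1, hρ2, hρ3⟩ := DefIn.exists_retract x T ⟨x, hxT⟩
    refine ⟨⟨⟨k, by omega⟩, fun a b => (g a).R (g b), fun φ hφ => ?_⟩, g, fun a b => Iff.rfl,
      fun y => ⟨fun hy => ⟨f y, hgf y hy⟩, ?_⟩⟩
    · have : Finite (G k fun a b => (g a).R (g b)).X := inferInstanceAs (Finite (Fin (k + 1)))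
      refine valid_of_definable_morphism h (x := x) f (fun a => ?_) ?_ ?_ ?_
        (fun a => ⟨g a, hg a, hfg a⟩) hφ
      · refine (hρ3 (g a)).congr fun y hy => ?_
        simp only [Set.mem_ofPred_eq, hρ1 y ((hT y).2 hy)]
        exact ⟨fun hya => by rw [hya, hfg], fun hya => by rw [← hya, hgf y hy]⟩
      · intro y z hy hyz
        change (g (f y)).R (g (f z))
        rwa [hgf y hy, hgf z (h.comp_rel hy hyz)]
      · intro y a hy hya
        refine ⟨g a, ?_, hfg a⟩
        have : (g (f y)).R (g a) := hya
        rwa [hgf y hy] at this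
      · intro y a hy hya
        refine ⟨g a, ?_, hfg a⟩
        have : (g a).R (g (f y)) := hya
        rwa [hgf y hy] at this
    · rintro ⟨a, rfl⟩
      exact hg a
  have hι : Nonempty ι := by
    obtain ⟨x, -⟩ := exists_world_of_notMem h.tense hcons
    obtain ⟨i, -⟩ := hcomp x
    exact ⟨i⟩
  refine ⟨KFrame.sigma fun i : ι => G i.1 i.2.1, inferInstanceAs (Finite (Σ i : ι, Fin (i.1 + 1))), ?_⟩
  ext φ
  simp only [Log, Set.mem_singleton_iff, forall_eq, Set.mem_ofPred_eq, KFrame.valid_sigma]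
  refine ⟨fun hφ i => i.2.2 φ hφ, fun hv => ?_⟩
  by_contra hφ
  obtain ⟨x, hx⟩ := exists_world_of_notMem h.tense hφ
  obtain ⟨i, g, hg, hgx⟩ := hcomp x
  obtain ⟨a, ha⟩ := (hgx x).1 (h.comp_refl x)
  have key := sat_iff_mem h.tense (F := G i.1 i.2.1) g φ.sub (fun a b hab => (hg a b).1 hab) (by
    intro a ψ _ z haz hz
    obtain ⟨b, rfl⟩ := (hgx z).1 (h.comp_rel ((hgx _).2 ⟨a, rfl⟩) haz)
    exact ⟨b, (hg a b).2 haz, hz⟩) (by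
    intro a ψ _ z haz hz
    obtain ⟨b, rfl⟩ := (hgx z).1 (h.comp_rel' ((hgx _).2 ⟨a, rfl⟩) haz)
    exact ⟨b, (hg b a).2 haz, hz⟩) φ subset_rfl a
  rw [ha] at key
  exact hx (key.1 (hv i _ a))

/-- A refutation on some chain bounds strict chains and so makes up-sets and down-sets definable;
only then do refutations on the four cluster families bound the clusters. The two bounds multiply to
a bound on components. -/
theorem isTabular_or_subset_family {L : Set Formula} (h : IsS43 L) (hcons : IsConsistent L) :
    IsTabular L ∨ ∃ τ : FrameType, L ⊆ Log τ.family := by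
  classical
  by_contra hc
  push Not at hc
  obtain ⟨htab, hτ⟩ := hc
  have hτ' : ∀ τ : FrameType, ∃ n, 2 ≤ n ∧ ∃ φ ∈ L, ¬ (τ.frame n).Valid φ := by
    intro τ
    obtain ⟨φ, hφ, hφ'⟩ := Set.not_subset.1 (hτ τ)
    rw [mem_Log_family] at hφ'
    push Not at hφ'
    obtain ⟨n, hn, hv⟩ := hφ'
    exact ⟨n, hn, φ, hφ, hv⟩
  choose N hN ψ hψ hv using hτ'
  have hch : ∀ l : List (World L), l.Pairwise World.Lt → l.length ≠ N .chain + 1 :=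
    fun l hl hlen => hv .chain (valid_chain_of_lt h hl hlen (hψ _))
  let M := ∑ b : Bool, ∑ t : Bool, (N (.cluster b t) + 1)
  have hNM : ∀ b t, N (.cluster b t) + 1 ≤ M := by
    intro b t
    simp only [M, Fintype.sum_bool]
    cases b <;> cases t <;> omega
  have hM : ∀ (y : World L) (C : Finset (World L)), (∀ c ∈ C, c.R y ∧ y.R c) → C.card ≤ M := by
    intro y C hC
    by_contra hcard
    let b : Bool := decide (∃ z, World.Lt z y)
    let t : Bool := decide (∃ z, World.Lt y z)
    obtain ⟨C', hC', hcard'⟩ := Finset.exists_subset_card_eq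
      (show N (.cluster b t) + 1 ≤ C.card by have := hNM b t; omega)
    let e := C'.equivFinOfCardEq hcard'
    exact hv (.cluster b t) (valid_cluster_of_card h (hN _) (y := y) (by simp [b]) (by simp [t])
      (h.defIn_up hch (h.comp_refl y)) (h.defIn_down hch (h.comp_refl y))
      (c := fun i => (e.symm i).1) (Subtype.val_injective.comp e.symm.injective)
      (fun i => hC _ (hC' (e.symm i).2)) (hψ _))
  refine htab (isTabular_of_card_le h hcons (K := N .chain * M) fun x T hT => ?_)
  by_contra hcard
  obtain ⟨l, hl, hlen, -⟩ := h.exists_lt_chain (N .chain) T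
    (fun a ha b hb => h.total (hT a ha) (hT b hb)) (fun y C _ => hM y C) (not_le.1 hcard)
  exact hch l hl hlen

/-! ### Decidability of validity in the finite frames -/

/-- Truth at `x ≤ n` in the frame on `{0, …, n}` with the relation `r`, under the valuation coded by
the binary digits of `v`. -/
def bsat (r : ℕ → ℕ → Prop) (n v : ℕ) : Formula → ℕ → Prop
  | .p i, x => v.testBit (i * (n + 1) + x) = true
  | .bot, _ => False
  | .imp φ ψ, x => bsat r n v φ x → bsat r n v ψ x
  | .box φ, x => ∀ y < n + 1, r x y → bsat r n v φ y
  | .bdia φ, x => ∃ y < n + 1, r y x ∧ bsat r n v φ y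

theorem sat_iff_bsat {τ : FrameType} {n v c : ℕ} {V : ℕ → Set (Fin (n + 1))}
    (hV : ∀ i ≤ c, ∀ x : Fin (n + 1), x ∈ V i ↔ v.testBit (i * (n + 1) + x) = true)
    {φ : Formula} (hφ : φ.code ≤ c) (x : Fin (n + 1)) :
    (τ.frame n).Sat V x φ ↔ bsat τ.rel n v φ x := by
  induction φ generalizing x with
  | p i =>
    simp only [code] at hφ
    exact hV i (by omega) x
  | bot => rfl
  | imp φ ψ h1 h2 =>
    have := Nat.add_le_pair φ.code ψ.code
    simp only [code] at hφ
    exact imp_congr (h1 (by omega) x) (h2 (by omega) x)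
  | box φ ih =>
    simp only [code] at hφ
    constructor
    · exact fun h y hy hxy => (ih (by omega) ⟨y, hy⟩).1 (h _ hxy)
    · exact fun h y hxy => (ih (by omega) y).2 (h y.val y.2 hxy)
  | bdia φ ih =>
    simp only [code] at hφ
    constructor
    · rintro ⟨y, hxy, h⟩
      exact ⟨y.val, y.2, hxy, (ih (by omega) y).1 h⟩
    · rintro ⟨y, hy, hxy, h⟩
      exact ⟨⟨y, hy⟩, hxy, (ih (by omega) ⟨y, hy⟩).2 h⟩

/-- A variable of `φ` has index at most `φ.code`, so only `(φ.code + 1) * (n + 1)` truth values of a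
valuation matter, and these are the bits of one number. -/
theorem valid_iff_bsat {τ : FrameType} {n : ℕ} {φ : Formula} :
    (τ.frame n).Valid φ ↔
      ∀ v < 2 ^ ((φ.code + 1) * (n + 1)), ∀ x < n + 1, bsat τ.rel n v φ x := by
  classical
  constructor
  · intro h v _ x hx
    exact (sat_iff_bsat (V := fun i => {x | v.testBit (i * (n + 1) + x) = true})
      (fun _ _ _ => Iff.rfl) le_rfl ⟨x, hx⟩).1 (h _ _)
  · intro h V x
    let f : Fin ((φ.code + 1) * (n + 1)) → Bool := fun k =>
      decide ((⟨k % (n + 1), Nat.mod_lt _ n.succ_pos⟩ : Fin (n + 1)) ∈ V (k / (n + 1)))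
    refine (sat_iff_bsat (v := Nat.ofBits f) (fun i hi x => ?_) le_rfl x).2
      (h _ (Nat.ofBits_lt_two_pow f) _ x.2)
    have hlt : i * (n + 1) + x.val < (φ.code + 1) * (n + 1) :=
      calc i * (n + 1) + x.val < i * (n + 1) + (n + 1) := by omega
        _ = (i + 1) * (n + 1) := by ring
        _ ≤ _ := Nat.mul_le_mul_right _ (by omega)
    have h1 : (i * (n + 1) + x.val) % (n + 1) = x.val := by
      rw [Nat.mul_add_mod_self_right, Nat.mod_eq_of_lt x.2]
    have h2 : (i * (n + 1) + x.val) / (n + 1) = i := by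
      rw [Nat.mul_comm, Nat.mul_add_div n.succ_pos, Nat.div_eq_of_lt x.2, Nat.add_zero]
    rw [Nat.testBit_ofBits_lt f _ hlt]
    simp only [f, h1, h2, Fin.eta, decide_eq_true_eq]
    exact Iff.rfl

/-! ### Primitive recursive evaluation of formulas -/

section

open Primrec

theorem PrimrecPred.forall_lt_of {α : Type*} [Primcodable α] {f : α → ℕ} (hf : Primrec f)
    {q : α × ℕ → Prop} (hq : PrimrecPred q) : PrimrecPred fun a => ∀ y < f a, q (a, y) :=
  ((PrimrecRel.forall_mem_list (R := fun y a => q (a, y))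
    (PrimrecPred.comp hq (Primrec.pair Primrec.snd Primrec.fst))).comp
      (list_range.comp hf) Primrec.id).of_eq fun a => by simp

theorem PrimrecPred.exists_lt_of {α : Type*} [Primcodable α] {f : α → ℕ} (hf : Primrec f)
    {q : α × ℕ → Prop} (hq : PrimrecPred q) : PrimrecPred fun a => ∃ y < f a, q (a, y) :=
  ((PrimrecRel.exists_mem_list (R := fun y a => q (a, y))
    (PrimrecPred.comp hq (Primrec.pair Primrec.snd Primrec.fst))).comp
      (list_range.comp hf) Primrec.id).of_eq fun a => by simp

theorem FrameType.primrecRel_rel (τ : FrameType) : PrimrecRel τ.rel := by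
  cases τ with
  | chain => exact nat_le
  | cluster b t =>
    have hi : Primrec fun a : ℕ × ℕ => a.1 := fst
    have hj : Primrec fun a : ℕ × ℕ => a.2 := snd
    have h0 (k : ℕ) : Primrec fun _ : ℕ × ℕ => k := const k
    have hb (k : Bool) : PrimrecPred fun _ : ℕ × ℕ => k = true :=
      Primrec.eq.comp (const k) (const true)
    refine (((hb b).not.or ((Primrec.eq.comp hj (h0 0)).not.or (Primrec.eq.comp hi (h0 0)))).and
      ((hb t).not.or ((Primrec.eq.comp hi (h0 1)).not.or
        (Primrec.eq.comp hj (h0 1))))).of_eq fun a => ?_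
    simp only [FrameType.rel]
    tauto

theorem primrec_two_pow : Primrec fun k : ℕ => 2 ^ k :=
  (Primrec₂.unpaired'.1 Nat.Primrec.pow).comp (const 2) Primrec.id

theorem primrecRel_testBit : PrimrecRel fun v k : ℕ => v.testBit k = true :=
  (Primrec.eq.comp (nat_mod.comp (nat_div.comp fst (primrec_two_pow.comp snd)) (const 2))
    (const 1)).of_eq fun a => by simp [Nat.testBit_eq_decide_div_mod_eq]

open Classical in
/-- The table of truth values of the formula with code `c`. -/
noncomputable def truthTable (r : ℕ → ℕ → Prop) (a : ℕ × ℕ) (c : ℕ) : List Bool :=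
  (List.range (a.1 + 1)).map fun x => decide (bsat r a.1 a.2 (Formula.decode c) x)

theorem truthTable_getD {r : ℕ → ℕ → Prop} {a : ℕ × ℕ} {c x : ℕ} (hx : x < a.1 + 1) :
    (truthTable r a c).getD x false = true ↔ bsat r a.1 a.2 (Formula.decode c) x := by
  simp [truthTable, List.getD_eq_getElem?_getD, hx]

/-- The recursion step for `truthTable`. -/
def truthStep (r : ℕ → ℕ → Prop) (q : ((ℕ × ℕ) × List (List Bool)) × ℕ) : Prop :=
  0 < q.1.2.length ∧
  (((q.1.2.length - 1) % 4 = 0 ∧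
      q.1.1.2.testBit ((q.1.2.length - 1) / 4 * (q.1.1.1 + 1) + q.2) = true) ∨
    ((q.1.2.length - 1) % 4 = 1 ∧ ∀ y < q.1.1.1 + 1, ¬ r q.2 y ∨
      (q.1.2.getD ((q.1.2.length - 1) / 4) []).getD y false = true) ∨
    ((q.1.2.length - 1) % 4 = 2 ∧ ∃ y < q.1.1.1 + 1, r y q.2 ∧
      (q.1.2.getD ((q.1.2.length - 1) / 4) []).getD y false = true) ∨
    ((q.1.2.length - 1) % 4 = 3 ∧
      (¬ (q.1.2.getD ((q.1.2.length - 1) / 4).unpair.1 []).getD q.2 false = true ∨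
        (q.1.2.getD ((q.1.2.length - 1) / 4).unpair.2 []).getD q.2 false = true)))

theorem primrecPred_truthStep {r : ℕ → ℕ → Prop} (hr : PrimrecRel r) :
    PrimrecPred (truthStep r) := by
  have hl : Primrec fun q : ((ℕ × ℕ) × List (List Bool)) × ℕ => q.1.2 := snd.comp fst
  have hc : Primrec fun q : ((ℕ × ℕ) × List (List Bool)) × ℕ => q.1.2.length :=
    list_length.comp hl
  have hm : Primrec fun q : ((ℕ × ℕ) × List (List Bool)) × ℕ => q.1.2.length - 1 :=
    nat_sub.comp hc (const 1)
  have hd : Primrec fun q : ((ℕ × ℕ) × List (List Bool)) × ℕ => (q.1.2.length - 1) / 4 :=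
    nat_div.comp hm (const 4)
  have hN : Primrec fun q : ((ℕ × ℕ) × List (List Bool)) × ℕ => q.1.1.1 + 1 :=
    succ.comp (fst.comp (fst.comp fst))
  have hcase (k : ℕ) : PrimrecPred fun q : ((ℕ × ℕ) × List (List Bool)) × ℕ =>
      (q.1.2.length - 1) % 4 = k := Primrec.eq.comp (nat_mod.comp hm (const 4)) (const k)
  have hget {f : ((ℕ × ℕ) × List (List Bool)) × ℕ → ℕ} (hf : Primrec f) :
      Primrec fun q : ((ℕ × ℕ) × List (List Bool)) × ℕ => q.1.2.getD (f q) [] :=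
    (list_getD []).comp hl hf
  have htrue {f : ((ℕ × ℕ) × List (List Bool)) × ℕ → ℕ} (hf : Primrec f) :
      PrimrecPred fun q : ((ℕ × ℕ) × List (List Bool)) × ℕ =>
        (q.1.2.getD (f q) []).getD q.2 false = true :=
    Primrec.eq.comp ((list_getD false).comp (hget hf) snd) (const true)
  have hbd : PrimrecPred fun s : (((ℕ × ℕ) × List (List Bool)) × ℕ) × ℕ =>
      (s.1.1.2.getD ((s.1.1.2.length - 1) / 4) []).getD s.2 false = true :=
    Primrec.eq.comp ((list_getD false).comp ((hget hd).comp fst) snd) (const true)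
  refine (nat_lt.comp (const 0) hc).and (((hcase 0).and ?_).or (((hcase 1).and ?_).or
    (((hcase 2).and ?_).or ((hcase 3).and ?_))))
  · exact primrecRel_testBit.comp (snd.comp (fst.comp fst)) (nat_add.comp (nat_mul.comp hd hN) snd)
  · exact PrimrecPred.forall_lt_of hN
      (q := fun s : (((ℕ × ℕ) × List (List Bool)) × ℕ) × ℕ => ¬ r s.1.2 s.2 ∨
        (s.1.1.2.getD ((s.1.1.2.length - 1) / 4) []).getD s.2 false = true)
      ((hr.comp (snd.comp fst) snd).not.or hbd)
  · exact PrimrecPred.exists_lt_of hN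
      (q := fun s : (((ℕ × ℕ) × List (List Bool)) × ℕ) × ℕ => r s.2 s.1.2 ∧
        (s.1.1.2.getD ((s.1.1.2.length - 1) / 4) []).getD s.2 false = true)
      ((hr.comp snd (snd.comp fst)).and hbd)
  · exact (htrue (fst.comp (unpair.comp hd))).not.or (htrue (snd.comp (unpair.comp hd)))

/-- Course-of-values recursion on codes: the list of earlier tables has length `c`, so it reveals
the code itself. For `c > 0`, `(c - 1) % 4` names the constructor and `(c - 1) / 4` its arguments,
whose codes lie below `c`; code `0` is falsum, excluded by the length condition. -/
theorem truthStep_iff {r : ℕ → ℕ → Prop} {a : ℕ × ℕ} {c x : ℕ} (hx : x < a.1 + 1) :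
    truthStep r ((a, (List.range c).map (truthTable r a)), x) ↔
      bsat r a.1 a.2 (Formula.decode c) x := by
  cases c with
  | zero => simp [truthStep, Formula.decode, bsat]
  | succ m =>
    have hget : ∀ k < m + 1,
        ((List.range (m + 1)).map (truthTable r a)).getD k [] = truthTable r a k := by
      intro k hk
      simp [List.getD_eq_getElem?_getD, hk]
    have h1 : m / 4 < m + 1 := Nat.lt_succ_of_le (Nat.div_le_self m 4)
    have h2 : (m / 4).unpair.1 < m + 1 := lt_of_le_of_lt (Nat.unpair_left_le _) h1
    have h3 : (m / 4).unpair.2 < m + 1 := lt_of_le_of_lt (Nat.unpair_right_le _) h1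
    simp only [truthStep, List.length_map, List.length_range, Nat.add_sub_cancel, hget _ h1,
      hget _ h2, hget _ h3, truthTable_getD hx]
    rw [Formula.decode]
    have hm : m % 4 < 4 := Nat.mod_lt _ (by norm_num)
    split_ifs with c0 c1 c2
    · simp [c0, bsat]
    · simp only [c1, bsat]
      simp only [one_ne_zero, false_and, false_or, Nat.succ_pos, true_and, OfNat.one_ne_ofNat,
        or_false]
      refine forall_congr' fun y => forall_congr' fun hy => ?_
      rw [truthTable_getD hy, imp_iff_not_or]
    · simp only [c2, bsat]
      simp only [OfNat.ofNat_ne_zero, OfNat.ofNat_ne_one, false_and, false_or, Nat.succ_pos,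
        true_and, Nat.reduceEqDiff, or_false]
      refine exists_congr fun y => and_congr_right fun hy => ?_
      rw [truthTable_getD hy]
    · have c3 : m % 4 = 3 := by omega
      simp only [c3, bsat]
      simp [imp_iff_not_or]

theorem primrec_truthTable {r : ℕ → ℕ → Prop} (hr : PrimrecRel r) : Primrec₂ (truthTable r) := by
  classical
  refine Primrec.nat_strong_rec (truthTable r) (g := fun a l =>
    some ((List.range (a.1 + 1)).map fun x => decide (truthStep r ((a, l), x)))) ?_ fun a c => ?_
  · exact option_some.comp (list_map (list_range.comp (succ.comp (fst.comp fst)))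
      (primrecPred_truthStep hr).decide.to₂)
  · refine congrArg some (List.map_congr_left fun x hx => ?_)
    exact decide_eq_decide.2 (truthStep_iff (List.mem_range.1 hx))

theorem primrecPred_valid (τ : FrameType) :
    PrimrecPred fun φ : Formula => (τ.frame (FrameType.bound φ)).Valid φ := by
  have hcode : Primrec Formula.code := Primrec.encode
  have hbound : Primrec FrameType.bound :=
    nat_add.comp (nat_mul.comp (const 2) hcode) (const 4)
  have hK : Primrec fun φ : Formula => 2 ^ ((φ.code + 1) * (FrameType.bound φ + 1)) :=
    primrec_two_pow.comp (nat_mul.comp (succ.comp hcode) (succ.comp hbound))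
  have hbody : PrimrecPred fun s : (Formula × ℕ) × ℕ =>
      (truthTable τ.rel (FrameType.bound s.1.1, s.1.2) s.1.1.code).getD s.2 false = true :=
    Primrec.eq.comp ((list_getD false).comp ((primrec_truthTable τ.primrecRel_rel).comp
      (Primrec.pair (hbound.comp (fst.comp fst)) (snd.comp fst)) (hcode.comp (fst.comp fst))) snd)
      (const true)
  refine (PrimrecPred.forall_lt_of hK (PrimrecPred.forall_lt_of
    (succ.comp (hbound.comp fst)) hbody)).of_eq fun φ => ?_
  rw [valid_iff_bsat]
  refine forall_congr' fun v => forall_congr' fun _ => forall_congr' fun x =>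
    forall_congr' fun hx => ?_
  rw [truthTable_getD (a := (FrameType.bound φ, v)) hx, Formula.decode_code]

end

/-! ### The main theorem -/

theorem finite_axS43 : axS43.Finite := by
  simp [axS43]

/-- A pretabular logic in a family's logic is that logic, and the axioms of the family suffice. -/
theorem eq_of_subset_family {L : Set Formula} (h : IsS43 L) (hpre : IsPretabular L)
    {τ : FrameType} (hτ : L ⊆ Log τ.family) :
    L = Log τ.family ∧ L = oplus Kt (axS43 ∪ τ.axioms) := by
  have h1 : L = Log τ.family := by
    by_contra hne
    exact not_isTabular_Log_family τ (hpre.tabular_of_ssubset _ (isTenseLogic_Log _)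
      (hτ.ssubset_of_ne hne) (isConsistent_Log_family τ))
  refine ⟨h1, ?_⟩
  set L' := oplus Kt (axS43 ∪ τ.axioms)
  have hax : axS43 ∪ τ.axioms ⊆ L' := subset_oplus_right _ _
  have hL' : IsS43 L' := ⟨isTenseLogic_oplus _ _,
    S43t_subset (isTenseLogic_oplus _ _) (Set.subset_union_left.trans hax)⟩
  refine Set.Subset.antisymm (fun φ hφ => ?_) (oplus_subset h.tense (Kt_subset h.tense)
    (Set.union_subset (axS43_subset.trans h.sub) (h1 ▸ τ.axioms_subset)))
  -- `L'` contains the axioms of the family, so a formula of `L` outside `L'` would be refuted on a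
  -- member of the family, all of which validate `L`.
  by_contra hc
  exact not_valid_of_notMem hL' (Set.subset_union_right.trans hax) hc le_rfl
    (mem_Log_family.1 (hτ hφ) _ (by simp [FrameType.bound]))

end Tense

theorem mainTheorem4 (L : Set Tense.Formula) (hL : L ∈ Tense.PTAB Tense.S43t) :
    Tense.IsFinitelyAxiomatizable L ∧ Tense.HasFMP L ∧ Tense.IsDecidable L := by
  obtain ⟨⟨hL1, hL2⟩, hpre⟩ := hL
  have h : Tense.IsS43 L := ⟨hL1, hL2⟩
  by_cases hcons : Tense.IsConsistent L
  · obtain ⟨τ, hτ⟩ := (Tense.isTabular_or_subset_family h hcons).resolve_left hpre.not_tabular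
    obtain ⟨h1, h2⟩ := Tense.eq_of_subset_family h hpre hτ
    refine ⟨⟨_, Tense.finite_axS43.union τ.axioms_finite, h2⟩, ?_, ?_⟩
    · refine Set.Subset.antisymm (fun φ hφ F hF => hF.2 φ hφ) fun φ hφ => ?_
      rw [h1, Tense.mem_Log_family]
      exact fun n hn => hφ _ ⟨inferInstance, fun ψ hψ => Tense.mem_Log_family.1 (hτ hψ) n hn⟩
    -- Membership of `φ` is equivalent to validity in the single frame of index `FrameType.bound φ`.
    · refine (Tense.primrecPred_valid τ).computablePred.of_eq fun φ => ⟨fun hv => ?_, fun hφ =>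
        Tense.mem_Log_family.1 (hτ hφ) _ (by simp [Tense.FrameType.bound])⟩
      by_contra hφ
      refine Tense.not_valid_of_notMem h (τ := τ) ?_ hφ le_rfl hv
      rw [h1]
      exact τ.axioms_subset
  -- The inconsistent logic also counts as pretabular: frames are nonempty, so it is not tabular,
  -- and it has no proper extension.
  · have hall : ∀ φ, φ ∈ L := fun φ =>
      hL1.mp _ φ (not_not.1 hcons) (hL1.taut _ fun v h0 hi => (hi _ _).2 fun hb => absurd hb h0)
    have huniv : L = Set.univ := Set.eq_univ_of_forall hall
    refine ⟨⟨{.bot}, Set.finite_singleton _, ?_⟩, ?_, ?_⟩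
    · refine Set.Subset.antisymm (fun φ _ => ?_) fun φ _ => hall φ
      have hT := Tense.isTenseLogic_oplus Tense.Kt {.bot}
      exact hT.mp _ φ (Tense.subset_oplus_right _ _ rfl)
        (hT.taut _ fun v h0 hi => (hi _ _).2 fun hb => absurd hb h0)
    · exact Set.Subset.antisymm (fun φ hφ F hF => hF.2 φ hφ) fun φ _ => hall φ
    · exact ComputablePred.of_eq (p := fun _ => True)
        (Primrec.eq.comp (Primrec.const 0) (Primrec.const 0)
          |>.of_eq fun _ => by simp).computablePred fun φ => by simp [hall]
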